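/- Let $d\in\mathbb N$ and let $\mathbb H^d=\mathbb R^d\times\mathbb R^d\times\mathbb R$ be the Heisenberg group with law $(p,q,t)(p',q',t')=(p+p',q+q',t+t'+p\cdot q')$ and Haar measure equal to Lebesgue measure. For $g\in\mathbb H^d$ put $L_g\psi(x)=\psi(g^{-1}x)$, and for $k\in\mathbb Z$ write $L_k=L_{(0,0,k)}$. For $\lambda\in\mathbb R\setminus\{0\}$ let $\Pi_\lambda$ be the Schrödinger representation on $L^2(\mathbb R^d)$, $$\Pi_\lambda(p,q,t)f(y)=e^{2\pi i\lambda t}e^{-2\pi i\lambda q\cdot y}f(y-p).$$ Let $\mathcal F\varphi(\lambda)=\int_{\mathbb H^d}\varphi(x)\,\Pi_\lambda(x)\,dx$ (weak operator integral) for $\varphi\in L^1(\mathbb H^d)\cap L^2(\mathbb H^d)$, extended by continuity to $\varphi\in L^2(\mathbb H^d)$ as a map into the Hilbert–Schmidt-operator-valued functions that are square integrable with respect to $|\lambda|^d\,d\lambda$. For $\varphi,\psi\in L^2(\mathbb H^d)$ and a.e. $\alpha\in(0,1]$ define the bracket $$[\varphi,\psi](\alpha)=\sum_{j\in\mathbb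 Z}\operatorname{trace}\bigl(\mathcal F\varphi(\alpha+j)\,\mathcal F\psi(\alpha+j)^{\dagger}\bigr)\,|\alpha+j|^d ,$$ and set $E_\psi=\{\alpha\in(0,1]:[\psi,\psi](\alpha)>0\}$ and $$S_\psi[\varphi](\alpha)=\chi_{E_\psi}(\alpha)\,\frac{[\varphi,\psi](\alpha)}{[\psi,\psi](\alpha)} .$$ Then, for every $\psi\in L^2(\mathbb H^d)$, the map $\varphi\mapsto S_\psi[\varphi]$ is a linear isometry from the closed subspace $\overline{\operatorname{span}\{L_k\psi:k\in\mathbb Z\}}\subseteq L^2(\mathbb H^d)$ onto the weighted Hilbert space $L^2\bigl((0,1],[\psi,\psi](\alpha)\,d\alpha\bigr)$. -/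

import Mathlib

open MeasureTheory Filter Topology Set
open scoped ENNReal

noncomputable section

namespace HeisenbergBracket

/-! ### The Heisenberg group -/

/-- The Heisenberg group `ℍ^d`, with underlying set `ℝ^d × ℝ^d × ℝ`. Its Haar measure is Lebesgue
measure, that is, the product `volume`. -/
abbrev Heisenberg (d : ℕ) : Type :=
  EuclideanSpace ℝ (Fin d) × EuclideanSpace ℝ (Fin d) × ℝ

/-- The group law `(p,q,t)(p',q',t') = (p + p', q + q', t + t' + p·q')`. -/
instance (d : ℕ) : Mul (Heisenberg d) :=
  ⟨fun x y => (x.1 + y.1, x.2.1 + y.2.1, x.2.2 + y.2.2 + inner ℝ x.1 y.2.1)⟩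

instance (d : ℕ) : One (Heisenberg d) := ⟨(0, 0, 0)⟩

instance (d : ℕ) : Inv (Heisenberg d) :=
  ⟨fun x => (-x.1, -x.2.1, -x.2.2 + inner ℝ x.1 x.2.1)⟩

theorem mul_def {d : ℕ} (x y : Heisenberg d) :
    x * y = (x.1 + y.1, x.2.1 + y.2.1, x.2.2 + y.2.2 + inner ℝ x.1 y.2.1) := rfl

theorem one_def {d : ℕ} : (1 : Heisenberg d) = (0, 0, 0) := rfl

theorem inv_def {d : ℕ} (x : Heisenberg d) :
    x⁻¹ = (-x.1, -x.2.1, -x.2.2 + inner ℝ x.1 x.2.1) := rfl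

instance (d : ℕ) : Group (Heisenberg d) :=
  Group.ofLeftAxioms
    (fun x y z => by
      simp only [mul_def, inner_add_left, inner_add_right]
      ext1
      · exact add_assoc _ _ _
      ext1
      · exact add_assoc _ _ _
      · simp only []
        ring)
    (fun x => by simp [mul_def, one_def])
    (fun x => by simp [mul_def, one_def, inv_def])

theorem measurePreserving_mul_left {d : ℕ} (g : Heisenberg d) :
    MeasurePreserving (fun x : Heisenberg d => g * x) volume volume := by
  have h2 : MeasurePreserving
      (fun z : EuclideanSpace ℝ (Fin d) × ℝ =>
        (g.2.1 + z.1, g.2.2 + z.2 + inner ℝ g.1 z.1)) volume volume := by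
    refine MeasurePreserving.skew_product (g := fun q t => g.2.2 + t + inner ℝ g.1 q)
      (measurePreserving_add_left volume g.2.1) ?_ ?_
    · fun_prop
    · refine ae_of_all _ fun q => ?_
      have h := (measurePreserving_add_left (volume : Measure ℝ)
        (g.2.2 + inner ℝ g.1 q)).map_eq
      rw [← h]
      congr 1
      funext t
      ring
  exact (measurePreserving_add_left volume g.1).prod h2

/-- The central element `(0, 0, t)`. -/
def central (d : ℕ) (t : ℝ) : Heisenberg d := (0, 0, t)

/-- The space `L²(ℍ^d)`. -/
abbrev L2H (d : ℕ) : Type := Lp ℂ 2 (volume : Measure (Heisenberg d))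

/-- The representation space `L²(ℝ^d)`. -/
abbrev L2E (d : ℕ) : Type := Lp ℂ 2 (volume : Measure (EuclideanSpace ℝ (Fin d)))

/-- Left translation `L_g ψ(x) = ψ(g⁻¹ x)` on `L²(ℍ^d)`. -/
def leftTranslation {d : ℕ} (g : Heisenberg d) (ψ : L2H d) : L2H d :=
  Lp.compMeasurePreserving (fun x => g⁻¹ * x) (measurePreserving_mul_left g⁻¹) ψ

/-! ### The Schrödinger representations and the group Fourier transform -/

/-- The function `y ↦ e^{2πiλt} e^{-2πiλ q·y} f(y - p)`, for `x = (p, q, t)`. -/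
def schrodingerFun {d : ℕ} (lam : ℝ) (x : Heisenberg d)
    (f : EuclideanSpace ℝ (Fin d) → ℂ) (y : EuclideanSpace ℝ (Fin d)) : ℂ :=
  Complex.exp ((2 * Real.pi * lam * x.2.2 : ℝ) * Complex.I) *
    Complex.exp ((-(2 * Real.pi * lam * inner ℝ x.2.1 y) : ℝ) * Complex.I) * f (y - x.1)

theorem memLp_schrodingerFun {d : ℕ} (lam : ℝ) (x : Heisenberg d) (f : L2E d) :
    MemLp (schrodingerFun lam x f) 2 volume := by
  have hf : MemLp (fun y => f (y - x.1)) 2 volume :=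
    (Lp.memLp f).comp_measurePreserving (measurePreserving_sub_right volume x.1)
  refine hf.congr_norm ?_ ?_
  · refine AEStronglyMeasurable.mul (Continuous.aestronglyMeasurable ?_) hf.1
    fun_prop
  · refine ae_of_all _ fun y => ?_
    simp only [schrodingerFun, norm_mul, Complex.norm_exp_ofReal_mul_I, one_mul]

/-- The Schrödinger representation `π_λ(x)` on `L²(ℝ^d)`. -/
def schrodinger {d : ℕ} (lam : ℝ) (x : Heisenberg d) (f : L2E d) : L2E d :=
  (memLp_schrodingerFun lam x f).toLp (schrodingerFun lam x f)

/-- `T = ∫ φ(x) π_λ(x) dx`, as a weak operator integral (used for integrable `φ`). -/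
def IsFourierIntegral {d : ℕ} (φ : L2H d) (lam : ℝ) (T : L2E d →L[ℂ] L2E d) : Prop :=
  ∀ f g : L2E d, inner ℂ g (T f) = ∫ x, φ x * inner ℂ g (schrodinger lam x f)

section HilbertSchmidt

variable {H : Type*} [NormedAddCommGroup H] [InnerProductSpace ℂ H] [CompleteSpace H]

variable (H) in
/-- The index set of a fixed Hilbert basis of `H`. -/
def basisIndex : Set H := (exists_hilbertBasis ℂ H).choose

variable (H) in
/-- A fixed Hilbert basis of `H`. -/
def basis : HilbertBasis (basisIndex H) ℂ H := (exists_hilbertBasis ℂ H).choose_spec.choose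

/-- The trace of an operator; it does not depend on the basis for trace class operators. -/
def trace (T : H →L[ℂ] H) : ℂ := ∑' i, inner ℂ (basis H i) (T (basis H i))

/-- The Hilbert–Schmidt inner product `trace (A B†)`, linear in `A`. -/
def hsInner (A B : H →L[ℂ] H) : ℂ := trace (A ∘L ContinuousLinearMap.adjoint B)

/-- The square of the Hilbert–Schmidt norm, equal to `∞` if `A` is not Hilbert–Schmidt. -/
def hsNormSq (A : H →L[ℂ] H) : ℝ≥0∞ := ∑' i, ‖A (basis H i)‖ₑ ^ 2

end HilbertSchmidt

/-- `F` is (a version of) the Fourier transform of `φ ∈ L²(ℍ^d)`: the pair `(φ, F)` is a limit of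
pairs `(φₙ, Fₙ)`, where `φₙ ∈ L¹ ∩ L²` and `Fₙ(λ) = ∫ φₙ(x) π_λ(x) dx`; the convergence is that of
`L²(ℍ^d)` for `φₙ`, and that of `L²(ℝ, |λ|^d dλ)` with values in the Hilbert–Schmidt operators
for `Fₙ`. -/
def IsFourierTransform {d : ℕ} (φ : L2H d) (F : ℝ → L2E d →L[ℂ] L2E d) : Prop :=
  (∀ f g : L2E d, AEMeasurable (fun lam => inner ℂ g (F lam f)) volume) ∧
  ∃ (φs : ℕ → L2H d) (Fs : ℕ → ℝ → L2E d →L[ℂ] L2E d),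
    (∀ n, Integrable (φs n) volume) ∧
    (∀ n, ∀ lam : ℝ, lam ≠ 0 → IsFourierIntegral (φs n) lam (Fs n lam)) ∧
    Tendsto φs atTop (𝓝 φ) ∧
    Tendsto (fun n => ∫⁻ lam : ℝ, hsNormSq (Fs n lam - F lam) * ENNReal.ofReal (|lam| ^ d))
      atTop (𝓝 0)

open Classical in
/-- The group Fourier transform `𝓕φ(λ)` of `φ ∈ L²(ℍ^d)`, determined for almost every `λ`. -/
def fourier {d : ℕ} (φ : L2H d) : ℝ → L2E d →L[ℂ] L2E d :=
  if h : ∃ F, IsFourierTransform φ F then h.choose else 0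

/-! ### The bracket map and the operator `S_ψ` -/

/-- The bracket `[φ, ψ](α) = ∑_{j ∈ ℤ} ⟨𝓕φ(α + j), 𝓕ψ(α + j)⟩_HS |α + j|^d`. -/
def bracket {d : ℕ} (φ ψ : L2H d) (α : ℝ) : ℂ :=
  ∑' j : ℤ, hsInner (fourier φ (α + j)) (fourier ψ (α + j)) * ((|α + j| ^ d : ℝ) : ℂ)

/-- The set `E_ψ = {α ∈ (0,1] : [ψ,ψ](α) > 0}`; the number `[ψ,ψ](α)` is real. -/
def positiveSet {d : ℕ} (ψ : L2H d) : Set ℝ :=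
  {α | α ∈ Ioc (0 : ℝ) 1 ∧ 0 < (bracket ψ ψ α).re}

/-- `S_ψ[φ](α) = χ_{E_ψ}(α) [φ,ψ](α) / [ψ,ψ](α)`. -/
def bracketQuotient {d : ℕ} (ψ φ : L2H d) : ℝ → ℂ :=
  (positiveSet ψ).indicator fun α => bracket φ ψ α / bracket ψ ψ α

/-- The measure `[ψ,ψ](α) dα` on `(0,1]`. -/
def weight {d : ℕ} (ψ : L2H d) : Measure ℝ :=
  (volume.restrict (Ioc (0 : ℝ) 1)).withDensity fun α => ENNReal.ofReal (bracket ψ ψ α).re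

/-- The closed linear span in `L²(ℍ^d)` of the translates `L_k ψ`, `k ∈ ℤ`, by the central
elements `(0, 0, k)`. -/
def cyclicSubspace {d : ℕ} (ψ : L2H d) : Submodule ℂ (L2H d) :=
  (Submodule.span ℂ (range fun k : ℤ => leftTranslation (central d k) ψ)).topologicalClosure

end HeisenbergBracket

end

/-! The Plancherel theorem turns the group Fourier transform into a linear isometry `U`
(`plancherelMap`) from `L²(ℍ^d)` into the scalar space `L²(ℝ × I)`. Here `I` indexes matrix
coefficients in a fixed Hilbert basis, and coefficients carry the factor `√(|λ|^d)`. For integrable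
`φ` the operator `∫ φ Π_λ` has an integral kernel obtained by Fourier transforms in `t` and then in
`q`, the latter evaluated at `λy`. Two Euclidean Plancherel identities apply, and the dilation `y ↦
λy` costs exactly the density `|λ|^d`.

The element `(0,0,k)` is central and acts under `Π_λ` by the scalar `e^{2πiλk}`. With `u = Uψ`, a
combination of translates `L_k ψ` is therefore sent to `m(λ)u`, where `m` is a 1-periodic
trigonometric polynomial. Folding the line onto `(0,1]` turns its squared norm into `∫ |m|² [ψ,ψ]`.
So `V : m ↦ (m ∘ modOne) · u` is an isometry from the weighted space into `L²(ℝ × I)` that agrees on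
exponentials with `U` on translates.

The weight is a finite measure of mass `‖ψ‖²`, so the exponentials are total in the weighted space
and `V⁻¹U` is an isometry of the cyclic subspace onto it. Finally `Uφ = (m ∘ modOne) · u` gives
`[φ,ψ] = m [ψ,ψ]`, which identifies `m` with `S_ψ[φ]`. Surjectivity of the Fourier transform plays
no role. -/

noncomputable section

namespace HeisenbergBracket

/-! ### Plancherel on Euclidean space, for the Fourier integral. -/

section Plancherel

open scoped FourierTransform SchwartzMap ContDiff

variable {V : Type*} [NormedAddCommGroup V] [InnerProductSpace ℝ V] [FiniteDimensional ℝ V]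
  [MeasurableSpace V] [BorelSpace V]

/-- Both sides have the same pairing with every test function, since either transform can be moved
onto the test function: for the `L²` transform by its compatibility with tempered distributions, for
the integral by Fubini. This lets Plancherel for the abstract `L²` transform be used on concrete
integrals. -/
theorem fourier_toLp_ae_eq {f : V → ℂ} (hf : Integrable f) (hf2 : MemLp f 2) :
    (𝓕 (hf2.toLp f) : Lp ℂ 2 (volume : Measure V)) =ᵐ[volume] 𝓕 f := by
  have hcont : Continuous (𝓕 f) := by
    exact VectorFourier.fourierIntegral_continuous Real.continuous_fourierChar
      (by exact continuous_inner) hf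
  refine ae_eq_of_integral_contDiff_smul_eq ((Lp.memLp _).locallyIntegrable one_le_two)
    hcont.locallyIntegrable fun g hg hgs => ?_
  have hg₁ : HasCompactSupport (Complex.ofRealCLM ∘ g) := hgs.comp_left rfl
  have hg₂ : ContDiff ℝ ∞ (Complex.ofRealCLM ∘ g) := by fun_prop
  set G : 𝓢(V, ℂ) := hg₁.toSchwartzMap hg₂ with hG
  have h := congrArg (fun T => T G) (Lp.fourier_toTemperedDistribution_eq (hf2.toLp f))
  simp only [TemperedDistribution.fourier_apply, Lp.toTemperedDistribution_apply] at h
  have h1 : ∀ x, G x = (g x : ℂ) := fun x => rfl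
  have h2 : ∫ x, 𝓕 (G : V → ℂ) x • f x = ∫ x, G x • 𝓕 f x := by
    have := VectorFourier.integral_fourierIntegral_smul_eq_flip (μ := volume) (ν := volume)
      (L := innerₗ V) Real.continuous_fourierChar (by exact continuous_inner) G.integrable hf
    rw [flip_innerₗ] at this
    exact this
  calc ∫ x, g x • (𝓕 (hf2.toLp f) : Lp ℂ 2 (volume : Measure V)) x
      = ∫ x, G x • (𝓕 (hf2.toLp f) : Lp ℂ 2 (volume : Measure V)) x := by
        simp [h1]
    _ = ∫ x, 𝓕 (G : V → ℂ) x • f x := by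
        rw [← h]
        refine integral_congr_ae ?_
        filter_upwards [hf2.coeFn_toLp] with x hx
        rw [hx, SchwartzMap.fourier_coe]
    _ = ∫ x, g x • 𝓕 f x := by rw [h2]; simp [h1]

theorem lintegral_enorm_sq_eq_eLpNorm {α : Type*} [MeasurableSpace α] {μ : Measure α}
    (f : α → ℂ) : ∫⁻ x, ‖f x‖ₑ ^ 2 ∂μ = eLpNorm f 2 μ ^ 2 := by
  rw [eLpNorm_eq_lintegral_rpow_enorm_toReal two_ne_zero ENNReal.ofNat_ne_top]
  simp only [ENNReal.toReal_ofNat, ENNReal.rpow_ofNat, one_div]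
  rw [← ENNReal.rpow_natCast, ← ENNReal.rpow_mul]
  norm_num

/-- Plancherel's theorem for square integrable integrable functions. -/
theorem lintegral_enorm_fourier_sq {f : V → ℂ} (hf : Integrable f) (hf2 : MemLp f 2) :
    ∫⁻ w, ‖𝓕 f w‖ₑ ^ 2 = ∫⁻ x, ‖f x‖ₑ ^ 2 := by
  rw [lintegral_enorm_sq_eq_eLpNorm, lintegral_enorm_sq_eq_eLpNorm,
    ← eLpNorm_congr_ae (fourier_toLp_ae_eq hf hf2), ← eLpNorm_congr_ae hf2.coeFn_toLp,
    ← Lp.enorm_def, ← Lp.enorm_def, ← ofReal_norm, ← ofReal_norm, Lp.norm_fourier_eq]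

end Plancherel

/-! ### Hilbert–Schmidt operators through their matrix coefficients. -/

section HilbertSchmidt

theorem tsum_enorm_inner_basis_sq {H : Type*} [NormedAddCommGroup H] [InnerProductSpace ℂ H]
    {ι : Type*} (b : HilbertBasis ι ℂ H) (x : H) :
    ∑' i, ‖inner ℂ (b i) x‖ₑ ^ 2 = ‖x‖ₑ ^ 2 := by
  have h : HasSum (fun i => ‖inner ℂ (b i) x‖ ^ 2) (‖x‖ ^ 2) := by
    have h1 := b.hasSum_inner_mul_inner x x
    have h2 := Complex.hasSum_re h1
    rw [inner_self_eq_norm_sq_to_K] at h2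
    convert h2 using 1
    · ext i
      rw [← inner_conj_symm x (b i), ← Complex.normSq_eq_conj_mul_self, Complex.ofReal_re,
        Complex.normSq_eq_norm_sq]
    · norm_cast
  have h3 := h.tsum_eq
  rw [← ofReal_norm, ← ENNReal.ofReal_pow (norm_nonneg _), ← h3,
    ENNReal.ofReal_tsum_of_nonneg (fun i => by positivity) h.summable]
  refine tsum_congr fun i => ?_
  rw [← ofReal_norm, ← ENNReal.ofReal_pow (norm_nonneg _)]

variable {H : Type*} [NormedAddCommGroup H] [InnerProductSpace ℂ H] [CompleteSpace H]

/-- Distinct orthonormal vectors are at distance `√2 > 1`, so the basis is a discrete subset of a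
second countable space. Countability is what makes sums over matrix indices measurable. -/
instance [SecondCountableTopology H] : Countable (basisIndex H) := by
  have h : Pairwise fun i j : basisIndex H => 1 < dist (basis H i) (basis H j) := by
    intro i j hij
    have h2 : dist (basis H i) (basis H j) ^ 2 = 2 := by
      rw [dist_eq_norm, @norm_sub_sq ℂ, (basis H).orthonormal.2 hij,
        (basis H).orthonormal.1 i, (basis H).orthonormal.1 j]
      norm_num
    have h0 : 0 ≤ dist (basis H i) (basis H j) := dist_nonneg
    nlinarith
  have hd : DiscreteTopology (range (basis H)) := by
    refine DiscreteTopology.of_forall_le_dist (r := 1) one_pos ?_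
    rintro ⟨_, i, rfl⟩ ⟨_, j, rfl⟩ hij
    refine (h fun e => hij ?_).le
    simp [e]
  have hc : Countable (range (basis H)) := TopologicalSpace.separableSpace_iff_countable.1 inferInstance
  have hinj : Function.Injective (basis H) := (basis H).orthonormal.linearIndependent.injective
  exact (Equiv.ofInjective _ hinj).countable_iff.2 hc

/-- The matrix coefficients of an operator in the fixed Hilbert basis. -/
def matrixCoeff (A : H →L[ℂ] H) (q : basisIndex H × basisIndex H) : ℂ :=
  inner ℂ (basis H q.1) (A (basis H q.2))

theorem matrixCoeff_add (A B : H →L[ℂ] H) (q) :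
    matrixCoeff (A + B) q = matrixCoeff A q + matrixCoeff B q := by
  simp [matrixCoeff]

theorem matrixCoeff_sub (A B : H →L[ℂ] H) (q) :
    matrixCoeff (A - B) q = matrixCoeff A q - matrixCoeff B q := by
  simp [matrixCoeff]

theorem matrixCoeff_smul (c : ℂ) (A : H →L[ℂ] H) (q) :
    matrixCoeff (c • A) q = c * matrixCoeff A q := by
  simp [matrixCoeff]

theorem hsNormSq_eq_tsum_matrixCoeff (A : H →L[ℂ] H) :
    hsNormSq A = ∑' q, ‖matrixCoeff A q‖ₑ ^ 2 := by
  rw [ENNReal.tsum_prod', ENNReal.tsum_comm]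
  exact tsum_congr fun j => (tsum_enorm_inner_basis_sq _ _).symm

theorem summable_norm_sq_of_tsum_enorm_sq_ne_top {ι : Type*} {a : ι → ℂ}
    (ha : ∑' i, ‖a i‖ₑ ^ 2 ≠ ∞) : Summable fun i => ‖a i‖ ^ 2 := by
  have := ENNReal.summable_toReal ha
  simpa using this

theorem summable_mul_conj {ι : Type*} {a b : ι → ℂ}
    (ha : ∑' i, ‖a i‖ₑ ^ 2 ≠ ∞) (hb : ∑' i, ‖b i‖ₑ ^ 2 ≠ ∞) :
    Summable fun i => a i * starRingEnd ℂ (b i) := by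
  refine Summable.of_norm_bounded ((summable_norm_sq_of_tsum_enorm_sq_ne_top ha).add
    (summable_norm_sq_of_tsum_enorm_sq_ne_top hb)) fun i => ?_
  rw [norm_mul, RCLike.norm_conj]
  nlinarith [sq_nonneg (‖a i‖ - ‖b i‖), sq_nonneg (‖a i‖), sq_nonneg (‖b i‖)]

/-- Each diagonal entry of `A B†` is `⟨A† b_i, B† b_i⟩`, which Parseval expands over `j`. Finite
Hilbert–Schmidt norms make the double family absolutely summable, so the iterated sum is a sum over
pairs. -/
theorem hsInner_eq_tsum_matrixCoeff {A B : H →L[ℂ] H} (hA : hsNormSq A ≠ ∞)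
    (hB : hsNormSq B ≠ ∞) :
    hsInner A B = ∑' q, matrixCoeff A q * starRingEnd ℂ (matrixCoeff B q) := by
  rw [hsNormSq_eq_tsum_matrixCoeff] at hA hB
  rw [(summable_mul_conj hA hB).tsum_prod]
  refine tsum_congr fun i => ?_
  rw [ContinuousLinearMap.comp_apply, ← ContinuousLinearMap.adjoint_inner_left,
    ← (basis H).tsum_inner_mul_inner]
  refine tsum_congr fun j => ?_
  rw [ContinuousLinearMap.adjoint_inner_left, ContinuousLinearMap.adjoint_inner_right,
    matrixCoeff, matrixCoeff, inner_conj_symm]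

/-- The columns of the matrix are vectors `w j` with `∑ ‖w j‖² < ∞`, and `T f = ∑ ⟨b_j, f⟩ w j`
converges and is bounded by Cauchy–Schwarz. It is used to recover operators from functions in the
coefficient space. -/
theorem exists_matrixCoeff_eq {a : basisIndex H × basisIndex H → ℂ}
    (ha : ∑' q, ‖a q‖ₑ ^ 2 ≠ ∞) : ∃ T : H →L[ℂ] H, ∀ q, matrixCoeff T q = a q := by
  classical
  have hsq := summable_norm_sq_of_tsum_enorm_sq_ne_top ha
  have hsq' : Summable fun q : basisIndex H × basisIndex H => ‖a (q.2, q.1)‖ ^ 2 :=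
    (Equiv.prodComm _ _).summable_iff.2 hsq
  have hcol : ∀ j, ∃ w : H, (∀ i, inner ℂ (basis H i) w = a (i, j)) ∧
      ‖w‖ ^ 2 = ∑' i, ‖a (i, j)‖ ^ 2 := by
    intro j
    have hj : Summable fun i => ‖a (i, j)‖ ^ 2 := hsq'.prod_factor j
    have hm : Memℓp (fun i => a (i, j)) 2 := memℓp_gen (by simpa using hj)
    refine ⟨(basis H).repr.symm ⟨_, hm⟩, fun i => ?_, ?_⟩
    · rw [← HilbertBasis.repr_apply_apply, LinearIsometryEquiv.apply_symm_apply]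
    · rw [LinearIsometryEquiv.norm_map]
      have := lp.norm_rpow_eq_tsum (p := 2) (by norm_num)
        (⟨_, hm⟩ : lp (fun _ : basisIndex H => ℂ) 2)
      simpa using this
  choose w hw hwn using hcol
  have hws : Summable fun j => ‖w j‖ ^ 2 := by
    simp only [hwn]
    exact hsq'.prod
  have hbs : ∀ f : H, HasSum (fun j => ‖inner ℂ (basis H j) f‖ ^ 2) (‖f‖ ^ 2) := by
    intro f
    have h := tsum_enorm_inner_basis_sq (basis H) f
    have h1 : ∑' j, ‖inner ℂ (basis H j) f‖ₑ ^ 2 ≠ ∞ := by rw [h]; simp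
    have h2 := (summable_norm_sq_of_tsum_enorm_sq_ne_top h1).hasSum
    have h3 := congrArg ENNReal.toReal h
    rw [ENNReal.tsum_toReal_eq (by simp)] at h3
    simp only [ENNReal.toReal_pow, toReal_enorm] at h3
    rwa [h3] at h2
  have hsum : ∀ f : H, Summable (fun j => ‖inner ℂ (basis H j) f • w j‖) ∧
      ∑' j, ‖inner ℂ (basis H j) f • w j‖ ≤ ‖f‖ * √(∑' j, ‖w j‖ ^ 2) := by
    intro f
    have h := Real.summable_and_inner_le_Lp_mul_Lq_tsum_of_nonneg (p := 2) (q := 2) (by constructor <;> norm_num)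
      (f := fun j => ‖inner ℂ (basis H j) f‖) (g := fun j => ‖w j‖) (fun _ => norm_nonneg _)
      (fun _ => norm_nonneg _) (by simpa using (hbs f).summable) (by simpa using hws)
    simp only [norm_smul]
    refine ⟨h.1, h.2.trans (le_of_eq ?_)⟩
    simp only [Real.rpow_ofNat, (hbs f).tsum_eq]
    rw [← Real.sqrt_eq_rpow, ← Real.sqrt_eq_rpow, Real.sqrt_sq (norm_nonneg _)]
  let T : H →ₗ[ℂ] H :=
    { toFun := fun f => ∑' j, inner ℂ (basis H j) f • w j
      map_add' := fun f g => by
        simp only [inner_add_right, add_smul]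
        exact (hsum f).1.of_norm.tsum_add (hsum g).1.of_norm
      map_smul' := fun c f => by
        simp only [inner_smul_right, mul_smul, RingHom.id_apply]
        exact (hsum f).1.of_norm.tsum_const_smul c }
  refine ⟨T.mkContinuous (√(∑' j, ‖w j‖ ^ 2)) fun f => ?_, fun q => ?_⟩
  · rw [mul_comm]
    exact (norm_tsum_le_tsum_norm (hsum f).1).trans (hsum f).2
  · have : T (basis H q.2) = w q.2 := by
      change ∑' j, inner ℂ (basis H j) (basis H q.2) • w j = _
      rw [tsum_eq_single q.2, inner_self_eq_norm_sq_to_K, (basis H).orthonormal.1]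
      · simp
      · intro j hj
        rw [(basis H).orthonormal.2 hj, zero_smul]
    rw [matrixCoeff, LinearMap.mkContinuous_apply, this, hw]

/-- Expanding `f` and then `g` in the basis writes the pairing as a limit of finite sums of
coefficients; the limit is along a countably generated filter because the basis is countable. -/
theorem aemeasurable_inner_of_matrixCoeff [SecondCountableTopology H] {α : Type*}
    [MeasurableSpace α] {μ : Measure α} {F : α → H →L[ℂ] H}
    (hF : ∀ q, AEMeasurable (fun x => matrixCoeff (F x) q) μ) (f g : H) :
    AEMeasurable (fun x => inner ℂ g (F x f)) μ := by
  have h1 : ∀ i, AEMeasurable (fun x => inner ℂ (basis H i) (F x f)) μ := by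
    intro i
    have hlim : ∀ x, Tendsto (fun s : Finset (basisIndex H) =>
        ∑ j ∈ s, inner ℂ (basis H j) f * matrixCoeff (F x) (i, j)) atTop
        (𝓝 (inner ℂ (basis H i) (F x f))) := by
      intro x
      have h := ((basis H).hasSum_repr f).mapL ((innerSL ℂ (basis H i)) ∘L (F x))
      simpa [HasSum, HilbertBasis.repr_apply_apply, matrixCoeff, inner_smul_right] using h
    exact aemeasurable_of_tendsto_metrizable_ae atTop
      (fun s => Finset.aemeasurable_fun_sum _ fun j _ => (hF (i, j)).const_mul _)
      (ae_of_all _ hlim)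
  have hlim : ∀ x, Tendsto (fun s : Finset (basisIndex H) =>
      ∑ i ∈ s, inner ℂ g (basis H i) * inner ℂ (basis H i) (F x f)) atTop
      (𝓝 (inner ℂ g (F x f))) := fun x => (basis H).hasSum_inner_mul_inner g (F x f)
  exact aemeasurable_of_tendsto_metrizable_ae atTop
    (fun s => Finset.aemeasurable_fun_sum _ fun i _ => (h1 i).const_mul _)
    (ae_of_all _ hlim)

end HilbertSchmidt

/-! ### The weak operator integral and its integral kernel. -/

section FourierIntegral

variable {d : ℕ}

instance : SecondCountableTopology (L2E d) :=
  haveI : Fact ((2 : ℝ≥0∞) ≠ ∞) := ⟨ENNReal.ofNat_ne_top⟩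
  Lp.SecondCountableTopology

theorem Lp_coeFn_measurable {α : Type*} [MeasurableSpace α] {μ : Measure α} {p : ℝ≥0∞}
    (f : Lp ℂ p μ) : Measurable f :=
  (Lp.stronglyMeasurable f).measurable

theorem lintegral_enorm_Lp_sq {α : Type*} [MeasurableSpace α] {μ : Measure α}
    (f : Lp ℂ 2 μ) : ∫⁻ x, ‖f x‖ₑ ^ 2 ∂μ = ‖f‖ₑ ^ 2 := by
  rw [lintegral_enorm_sq_eq_eLpNorm, Lp.enorm_def]

theorem measurable_schrodingerFun (f : L2E d) :
    Measurable fun z : (ℝ × Heisenberg d) × EuclideanSpace ℝ (Fin d) =>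
      schrodingerFun z.1.1 z.1.2 f z.2 := by
  have hf := Lp_coeFn_measurable f
  unfold schrodingerFun
  refine Measurable.mul (Measurable.mul ?_ ?_) (hf.comp ?_)
  · exact Continuous.measurable (by fun_prop)
  · exact Continuous.measurable (by fun_prop)
  · fun_prop

theorem coeFn_schrodinger (lam : ℝ) (x : Heisenberg d) (f : L2E d) :
    schrodinger lam x f =ᵐ[volume] schrodingerFun lam x f :=
  MemLp.coeFn_toLp _

theorem norm_schrodingerFun (lam : ℝ) (x : Heisenberg d) (f : EuclideanSpace ℝ (Fin d) → ℂ)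
    (y : EuclideanSpace ℝ (Fin d)) : ‖schrodingerFun lam x f y‖ = ‖f (y - x.1)‖ := by
  simp only [schrodingerFun, norm_mul, Complex.norm_exp_ofReal_mul_I, one_mul]

theorem norm_schrodinger (lam : ℝ) (x : Heisenberg d) (f : L2E d) :
    ‖schrodinger lam x f‖ = ‖f‖ := by
  rw [schrodinger, Lp.norm_toLp, Lp.norm_def]
  congr 1
  rw [← eLpNorm_comp_measurePreserving (Lp.aestronglyMeasurable f)
    (measurePreserving_sub_right volume x.1)]
  exact eLpNorm_congr_norm_ae (ae_of_all _ fun y => norm_schrodingerFun lam x f y)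

theorem schrodinger_add (lam : ℝ) (x : Heisenberg d) (f g : L2E d) :
    schrodinger lam x (f + g) = schrodinger lam x f + schrodinger lam x g := by
  refine Lp.ext ?_
  have h := (measurePreserving_sub_right volume x.1).quasiMeasurePreserving.ae (Lp.coeFn_add f g)
  filter_upwards [coeFn_schrodinger lam x (f + g), coeFn_schrodinger lam x f,
    coeFn_schrodinger lam x g, Lp.coeFn_add (schrodinger lam x f) (schrodinger lam x g), h]
    with y h1 h2 h3 h4 h5
  rw [h1, h4, Pi.add_apply, h2, h3]
  simp only [schrodingerFun, h5, Pi.add_apply]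
  ring

theorem schrodinger_smul (lam : ℝ) (x : Heisenberg d) (c : ℂ) (f : L2E d) :
    schrodinger lam x (c • f) = c • schrodinger lam x f := by
  refine Lp.ext ?_
  have h := (measurePreserving_sub_right volume x.1).quasiMeasurePreserving.ae
    (Lp.coeFn_smul c f)
  filter_upwards [coeFn_schrodinger lam x (c • f), coeFn_schrodinger lam x f,
    Lp.coeFn_smul c (schrodinger lam x f), h] with y h1 h2 h4 h5
  rw [h1, h4, Pi.smul_apply, h2]
  simp only [schrodingerFun, h5, Pi.smul_apply, smul_eq_mul]
  ring

theorem inner_schrodinger (lam : ℝ) (x : Heisenberg d) (f g : L2E d) :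
    inner ℂ g (schrodinger lam x f) =
      ∫ y, schrodingerFun lam x f y * starRingEnd ℂ (g y) := by
  rw [L2.inner_def]
  refine integral_congr_ae ?_
  filter_upwards [coeFn_schrodinger lam x f] with y hy
  rw [hy, RCLike.inner_apply]

theorem norm_inner_schrodinger_le (lam : ℝ) (x : Heisenberg d) (f g : L2E d) :
    ‖inner ℂ g (schrodinger lam x f)‖ ≤ ‖g‖ * ‖f‖ := by
  simpa only [norm_schrodinger] using norm_inner_le_norm (𝕜 := ℂ) g (schrodinger lam x f)

theorem stronglyMeasurable_inner_schrodinger (f g : L2E d) :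
    StronglyMeasurable fun z : ℝ × Heisenberg d => inner ℂ g (schrodinger z.1 z.2 f) := by
  simp only [inner_schrodinger]
  have h : Measurable fun w : (ℝ × Heisenberg d) × EuclideanSpace ℝ (Fin d) =>
      schrodingerFun w.1.1 w.1.2 f w.2 * starRingEnd ℂ (g w.2) := by
    exact (measurable_schrodingerFun f).mul
      ((Complex.continuous_conj.measurable.comp (Lp_coeFn_measurable g)).comp measurable_snd)
  exact h.stronglyMeasurable.integral_prod_right'

theorem integrable_mul_inner_schrodinger {φ : L2H d} (hφ : Integrable φ volume) (lam : ℝ)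
    (f g : L2E d) : Integrable fun x => φ x * inner ℂ g (schrodinger lam x f) := by
  refine hφ.mul_bdd (c := ‖g‖ * ‖f‖) ?_ (ae_of_all _ fun x => norm_inner_schrodinger_le lam x f g)
  exact ((stronglyMeasurable_inner_schrodinger f g).comp_measurable
    (measurable_const.prodMk measurable_id)).aestronglyMeasurable

/-- The representation is unitary, so the sesquilinear form is bounded by `‖φ‖₁ ‖f‖ ‖g‖` and is
represented by an operator. -/
theorem exists_isFourierIntegral {φ : L2H d} (hφ : Integrable φ volume) (lam : ℝ) :
    ∃ T, IsFourierIntegral φ lam T := by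
  -- The conjugate makes the form antilinear in `f` and linear in `g`, as
  -- `continuousLinearMapOfBilin` requires; it is undone at the end.
  let B : L2E d →ₗ⋆[ℂ] L2E d →ₗ[ℂ] ℂ := LinearMap.mk₂'ₛₗ (starRingEnd ℂ) (RingHom.id ℂ)
    (fun f g => starRingEnd ℂ (∫ x, φ x * inner ℂ g (schrodinger lam x f)))
    (fun f f' g => by
      simp only [schrodinger_add, inner_add_right, mul_add]
      rw [integral_add (integrable_mul_inner_schrodinger hφ lam f g)
        (integrable_mul_inner_schrodinger hφ lam f' g), map_add])
    (fun c f g => by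
      simp only [schrodinger_smul, inner_smul_right, mul_left_comm _ c]
      rw [integral_const_mul, map_mul, smul_eq_mul])
    (fun f g g' => by
      simp only [inner_add_left, mul_add]
      rw [integral_add (integrable_mul_inner_schrodinger hφ lam f g)
        (integrable_mul_inner_schrodinger hφ lam f g'), map_add])
    (fun c f g => by
      simp only [inner_smul_left, mul_left_comm _ (starRingEnd ℂ c)]
      rw [integral_const_mul, map_mul, smul_eq_mul, Complex.conj_conj, RingHom.id_apply])
  have hB : ∀ f g, ‖B f g‖ ≤ (∫ x, ‖φ x‖) * ‖f‖ * ‖g‖ := by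
    intro f g
    change ‖starRingEnd ℂ (∫ x, φ x * inner ℂ g (schrodinger lam x f))‖ ≤ _
    rw [RCLike.norm_conj, mul_assoc, ← integral_mul_const]
    refine norm_integral_le_of_norm_le (hφ.norm.mul_const _) (ae_of_all _ fun x => ?_)
    rw [norm_mul, mul_comm ‖f‖]
    exact mul_le_mul_of_nonneg_left (norm_inner_schrodinger_le lam x f g) (norm_nonneg _)
  refine ⟨InnerProductSpace.continuousLinearMapOfBilin (B.mkContinuous₂ _ hB), fun f g => ?_⟩
  rw [← inner_conj_symm, InnerProductSpace.continuousLinearMapOfBilin_apply]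
  exact Complex.conj_conj _

theorem IsFourierIntegral.unique {φ : L2H d} {lam : ℝ} {T T' : L2E d →L[ℂ] L2E d}
    (h : IsFourierIntegral φ lam T) (h' : IsFourierIntegral φ lam T') : T = T' := by
  ext1 f
  exact ext_inner_left ℂ fun g => (h f g).trans (h' f g).symm

theorem IsFourierIntegral.add {φ φ' : L2H d} (hφ : Integrable φ volume)
    (hφ' : Integrable φ' volume) {lam : ℝ} {T T' : L2E d →L[ℂ] L2E d}
    (h : IsFourierIntegral φ lam T) (h' : IsFourierIntegral φ' lam T') :
    IsFourierIntegral (φ + φ') lam (T + T') := by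
  intro f g
  rw [add_apply, inner_add_right, h f g, h' f g,
    ← integral_add (integrable_mul_inner_schrodinger hφ lam f g)
      (integrable_mul_inner_schrodinger hφ' lam f g)]
  refine integral_congr_ae ?_
  filter_upwards [Lp.coeFn_add φ φ'] with x hx
  rw [hx, Pi.add_apply, add_mul]

theorem IsFourierIntegral.smul {φ : L2H d} {lam : ℝ} {T : L2E d →L[ℂ] L2E d} (c : ℂ)
    (h : IsFourierIntegral φ lam T) : IsFourierIntegral (c • φ) lam (c • T) := by
  intro f g
  rw [smul_apply, inner_smul_right, h f g, ← integral_const_mul]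
  refine integral_congr_ae ?_
  filter_upwards [Lp.coeFn_smul c φ] with x hx
  rw [hx, Pi.smul_apply, smul_eq_mul, mul_assoc]

theorem aemeasurable_inner_of_isFourierIntegral {φ : L2H d} {F : ℝ → L2E d →L[ℂ] L2E d}
    (hF : ∀ lam : ℝ, lam ≠ 0 → IsFourierIntegral φ lam (F lam)) (f g : L2E d) :
    AEMeasurable (fun lam => inner ℂ g (F lam f)) volume := by
  have hm : StronglyMeasurable fun lam : ℝ => ∫ x, φ x * inner ℂ g (schrodinger lam x f) := by
    refine StronglyMeasurable.integral_prod_right'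
      (f := fun z : ℝ × Heisenberg d => φ z.2 * inner ℂ g (schrodinger z.1 z.2 f)) ?_
    exact ((Lp.stronglyMeasurable φ).comp_measurable measurable_snd).mul
      (stronglyMeasurable_inner_schrodinger f g)
  refine ⟨_, hm.measurable, ?_⟩
  filter_upwards [Measure.ae_ne volume (0 : ℝ)] with lam hlam
  exact hF lam hlam f g

/-! ### The integral kernel of the Fourier transform -/

/-- The Fourier transform of `φ` in the central variable. -/
def centralFourier (φ : L2H d) (lam : ℝ) (p q : EuclideanSpace ℝ (Fin d)) : ℂ :=
  ∫ t : ℝ, φ (p, q, t) * Complex.exp ((2 * Real.pi * lam * t : ℝ) * Complex.I)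

/-- `fourierKernel φ lam p y` is the value at `(y, y - p)` of the integral kernel of the operator
`∫ φ(x) π_λ(x) dx`. -/
def fourierKernel (φ : L2H d) (lam : ℝ) (p y : EuclideanSpace ℝ (Fin d)) : ℂ :=
  ∫ q, centralFourier φ lam p q *
    Complex.exp ((-(2 * Real.pi * lam * inner ℝ q y) : ℝ) * Complex.I)

theorem measurable_centralFourier (φ : L2H d) :
    Measurable fun z : ℝ × EuclideanSpace ℝ (Fin d) × EuclideanSpace ℝ (Fin d) =>
      centralFourier φ z.1 z.2.1 z.2.2 := by
  have h : Measurable fun w : (ℝ × EuclideanSpace ℝ (Fin d) × EuclideanSpace ℝ (Fin d)) × ℝ =>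
      φ (w.1.2.1, w.1.2.2, w.2) *
        Complex.exp ((2 * Real.pi * w.1.1 * w.2 : ℝ) * Complex.I) := by
    refine Measurable.mul ((Lp_coeFn_measurable φ).comp ?_) ?_
    · fun_prop
    · exact Continuous.measurable (by fun_prop)
  exact h.stronglyMeasurable.integral_prod_right'.measurable

theorem measurable_fourierKernel (φ : L2H d) (lam : ℝ) :
    Measurable fun z : EuclideanSpace ℝ (Fin d) × EuclideanSpace ℝ (Fin d) =>
      fourierKernel φ lam z.1 z.2 := by
  have h : Measurable fun w : (EuclideanSpace ℝ (Fin d) × EuclideanSpace ℝ (Fin d)) ×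
      EuclideanSpace ℝ (Fin d) => centralFourier φ lam w.1.1 w.2 *
        Complex.exp ((-(2 * Real.pi * lam * inner ℝ w.2 w.1.2) : ℝ) * Complex.I) := by
    refine Measurable.mul ?_ ?_
    · exact (measurable_centralFourier φ).comp
        (by fun_prop : Measurable fun w : (EuclideanSpace ℝ (Fin d) × EuclideanSpace ℝ (Fin d)) ×
          EuclideanSpace ℝ (Fin d) => (lam, w.1.1, w.2))
    · exact Continuous.measurable (by fun_prop)
  exact h.stronglyMeasurable.integral_prod_right'.measurable

end FourierIntegral

/-! ### Plancherel on the Heisenberg group for `L¹ ∩ L²`. -/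

section PlancherelHeisenberg

open scoped FourierTransform

variable {d : ℕ}

theorem lintegral_volume_prod {α β : Type*} [MeasureSpace α] [MeasureSpace β]
    [SFinite (volume : Measure β)] {f : α × β → ℝ≥0∞} (hf : Measurable f) :
    ∫⁻ z, f z = ∫⁻ x, ∫⁻ y, f (x, y) :=
  lintegral_prod f hf.aemeasurable

theorem integral_volume_prod {α β : Type*} [MeasureSpace α] [MeasureSpace β]
    [SFinite (volume : Measure α)] [SFinite (volume : Measure β)] {f : α × β → ℂ}
    (hf : Integrable f) : ∫ z, f z = ∫ x, ∫ y, f (x, y) :=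
  integral_prod f hf

theorem memLp_two_prod_right_ae {α β : Type*} [MeasurableSpace α] [MeasurableSpace β]
    {μ : Measure α} {ν : Measure β} [SFinite μ] [SFinite ν] {f : α × β → ℂ} (hfm : Measurable f)
    (hf : ∫⁻ z, ‖f z‖ₑ ^ 2 ∂μ.prod ν ≠ ∞) : ∀ᵐ x ∂μ, MemLp (fun y => f (x, y)) 2 ν := by
  rw [lintegral_prod _ (by fun_prop)] at hf
  filter_upwards [ae_lt_top (by fun_prop) hf] with x hx
  refine ⟨(hfm.comp measurable_prodMk_left).aestronglyMeasurable, ?_⟩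
  rw [lintegral_enorm_sq_eq_eLpNorm] at hx
  exact lt_of_not_ge fun h => by simp [top_le_iff.1 h] at hx

theorem fourier_neg_eq_centralFourier (φ : L2H d) (lam : ℝ) (p q : EuclideanSpace ℝ (Fin d)) :
    centralFourier φ lam p q = 𝓕 (fun t => φ (p, q, t)) (-lam) := by
  rw [Real.fourier_eq', centralFourier]
  refine integral_congr_ae (ae_of_all _ fun t => ?_)
  simp only [smul_eq_mul, RCLike.inner_apply, conj_trivial]
  rw [mul_comm]
  congr 4
  ring

/-- The frequency is `λy` rather than `y`; this dilation is the source of the Plancherel density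
`|λ|^d`. -/
theorem fourier_smul_eq_fourierKernel (φ : L2H d) (lam : ℝ) (p y : EuclideanSpace ℝ (Fin d)) :
    fourierKernel φ lam p y = 𝓕 (fun q => centralFourier φ lam p q) (lam • y) := by
  rw [Real.fourier_eq', fourierKernel]
  refine integral_congr_ae (ae_of_all _ fun q => ?_)
  simp only [smul_eq_mul, inner_smul_right]
  rw [mul_comm]
  congr 4
  ring

/-- Tonelli reduces to one-dimensional Plancherel on almost every slice; the sign in `-lam` is
absorbed by reflection invariance. -/
theorem lintegral_enorm_partial_fourier_sq {α : Type*} [MeasureSpace α]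
    [SFinite (volume : Measure α)] {u : α × ℝ → ℂ} (hum : Measurable u) (hu : Integrable u)
    (hu2 : MemLp u 2) :
    ∫⁻ lam, ∫⁻ a, ‖𝓕 (fun t => u (a, t)) (-lam)‖ₑ ^ 2 = ∫⁻ z, ‖u z‖ₑ ^ 2 := by
  have h2 : ∫⁻ z, ‖u z‖ₑ ^ 2 ≠ ∞ := by
    rw [lintegral_enorm_sq_eq_eLpNorm]
    exact ENNReal.pow_ne_top hu2.2.ne
  have hm : Measurable fun w : ℝ × α => 𝓕 (fun t => u (w.2, t)) (-w.1) := by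
    simp only [Real.fourier_eq']
    have h : Measurable fun w : (ℝ × α) × ℝ =>
        Complex.exp ((-2 * Real.pi * inner ℝ w.2 (-w.1.1) : ℝ) * Complex.I) • u (w.1.2, w.2) := by
      have h1 : Measurable fun w : (ℝ × α) × ℝ =>
        Complex.exp ((-2 * Real.pi * inner ℝ w.2 (-w.1.1) : ℝ) * Complex.I) := by fun_prop
      exact h1.smul (hum.comp ((measurable_snd.comp measurable_fst).prodMk measurable_snd))
    exact h.stronglyMeasurable.integral_prod_right'.measurable
  rw [lintegral_lintegral_swap (hm.enorm.pow_const 2).aemeasurable,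
    lintegral_volume_prod (hum.enorm.pow_const 2)]
  have hq1 : ∀ᵐ a, MemLp (fun t : ℝ => u (a, t)) 2 volume := memLp_two_prod_right_ae hum h2
  have hq2 : ∀ᵐ a, Integrable (fun t : ℝ => u (a, t)) volume := Integrable.prod_right_ae hu
  refine lintegral_congr_ae ?_
  filter_upwards [hq1, hq2] with a h3 h4
  rw [← lintegral_enorm_fourier_sq h4 h3]
  exact lintegral_neg_eq_self (fun s => ‖𝓕 (fun t => u (a, t)) s‖ₑ ^ 2)

theorem measurable_lintegral_centralFourier (φ : L2H d) :
    Measurable fun z : ℝ × EuclideanSpace ℝ (Fin d) =>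
      ∫⁻ q, ‖centralFourier φ z.1 z.2 q‖ₑ ^ 2 := by
  have h : Measurable fun w : (ℝ × EuclideanSpace ℝ (Fin d)) × EuclideanSpace ℝ (Fin d) =>
      ‖centralFourier φ w.1.1 w.1.2 w.2‖ₑ ^ 2 :=
    ((measurable_centralFourier φ).comp (by fun_prop : Measurable fun w : (ℝ ×
      EuclideanSpace ℝ (Fin d)) × EuclideanSpace ℝ (Fin d) =>
        (w.1.1, w.1.2, w.2))).enorm.pow_const 2
  exact h.lintegral_prod_right'

theorem lintegral_enorm_centralFourier_sq {φ : L2H d} (hφ : Integrable φ volume) :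
    ∫⁻ lam, ∫⁻ p, ∫⁻ q, ‖centralFourier φ lam p q‖ₑ ^ 2 = ‖φ‖ₑ ^ 2 := by
  have hφm := Lp_coeFn_measurable φ
  have hφ2 : ∫⁻ x, ‖φ x‖ₑ ^ 2 ≠ ∞ := by rw [lintegral_enorm_Lp_sq]; simp
  rw [lintegral_lintegral_swap (measurable_lintegral_centralFourier φ).aemeasurable,
    ← lintegral_enorm_Lp_sq, lintegral_volume_prod (hφm.enorm.pow_const 2)]
  have hp1 : ∀ᵐ p, MemLp (fun z : EuclideanSpace ℝ (Fin d) × ℝ => φ (p, z)) 2 volume :=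
    memLp_two_prod_right_ae hφm hφ2
  have hp2 : ∀ᵐ p, Integrable (fun z : EuclideanSpace ℝ (Fin d) × ℝ => φ (p, z)) volume :=
    Integrable.prod_right_ae hφ
  refine lintegral_congr_ae ?_
  filter_upwards [hp1, hp2] with p h1 h2
  have hpm : Measurable fun z : EuclideanSpace ℝ (Fin d) × ℝ => φ (p, z) :=
    hφm.comp measurable_prodMk_left
  rw [← lintegral_enorm_partial_fourier_sq hpm h2 h1]
  simp only [fourier_neg_eq_centralFourier]

theorem integrable_centralFourier {φ : L2H d} (hφ : Integrable φ volume) (lam : ℝ) :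
    ∀ᵐ p, Integrable (fun q => centralFourier φ lam p q) volume := by
  have h : ∀ᵐ p, Integrable (fun z : EuclideanSpace ℝ (Fin d) × ℝ => φ (p, z)) volume :=
    Integrable.prod_right_ae hφ
  filter_upwards [h] with p hp
  have h2 : Integrable (fun z : EuclideanSpace ℝ (Fin d) × ℝ => φ (p, z) *
      Complex.exp ((2 * Real.pi * lam * z.2 : ℝ) * Complex.I)) volume := by
    refine hp.mul_bdd (c := 1) ?_ (ae_of_all _ fun z => (Complex.norm_exp_ofReal_mul_I _).le)
    exact Continuous.aestronglyMeasurable (by fun_prop)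
  exact h2.integral_prod_left

theorem lintegral_comp_smul_addHaar {lam : ℝ} (hlam : lam ≠ 0)
    (f : EuclideanSpace ℝ (Fin d) → ℝ≥0∞) :
    (∫⁻ y, f (lam • y)) * ENNReal.ofReal (|lam| ^ d) = ∫⁻ y, f y := by
  have h := (Homeomorph.smulOfNeZero lam hlam :
    EuclideanSpace ℝ (Fin d) ≃ₜ EuclideanSpace ℝ (Fin d)).measurableEmbedding.lintegral_map f
      (μ := (volume : Measure (EuclideanSpace ℝ (Fin d))))
  have h2 : Measure.map (fun y : EuclideanSpace ℝ (Fin d) => lam • y) volume = _ :=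
    Measure.map_addHaar_smul volume hlam
  have h3 : ∫⁻ y, f (lam • y) = ENNReal.ofReal (|(lam ^ d)⁻¹|) * ∫⁻ y, f y := by
    refine h.symm.trans ?_
    change ∫⁻ y, f y ∂(Measure.map (fun y : EuclideanSpace ℝ (Fin d) => lam • y) volume) = _
    rw [h2, lintegral_smul_measure, smul_eq_mul, finrank_euclideanSpace_fin]
  rw [h3, mul_right_comm, ← ENNReal.ofReal_mul (abs_nonneg _), abs_inv, abs_pow,
    inv_mul_cancel₀ (by positivity), ENNReal.ofReal_one, one_mul]

/-- Plancherel in `q` on almost every slice `p`, followed by the dilation `y ↦ λy`. The finiteness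
assumption provides square integrable slices. -/
theorem lintegral_enorm_fourierKernel_sq {φ : L2H d} (hφ : Integrable φ volume) {lam : ℝ}
    (hlam : lam ≠ 0) (h : ∫⁻ p, ∫⁻ q, ‖centralFourier φ lam p q‖ₑ ^ 2 ≠ ∞) :
    (∫⁻ p, ∫⁻ y, ‖fourierKernel φ lam p y‖ₑ ^ 2) * ENNReal.ofReal (|lam| ^ d) =
      ∫⁻ p, ∫⁻ q, ‖centralFourier φ lam p q‖ₑ ^ 2 := by
  have hm : Measurable fun z : EuclideanSpace ℝ (Fin d) × EuclideanSpace ℝ (Fin d) =>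
      centralFourier φ lam z.1 z.2 := (measurable_centralFourier φ).comp measurable_prodMk_left
  have hk := measurable_fourierKernel φ lam
  rw [← lintegral_mul_const _ (hk.enorm.pow_const 2).lintegral_prod_right']
  have h2 : ∀ᵐ p, MemLp (fun q => centralFourier φ lam p q) 2 volume := by
    refine memLp_two_prod_right_ae (μ := volume) hm ?_
    rw [lintegral_prod _ (hm.enorm.pow_const 2).aemeasurable]
    exact h
  refine lintegral_congr_ae ?_
  filter_upwards [h2, integrable_centralFourier hφ lam] with p h3 h4
  rw [← lintegral_enorm_fourier_sq h4 h3]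
  simp only [fourier_smul_eq_fourierKernel]
  exact lintegral_comp_smul_addHaar hlam (fun w => ‖𝓕 (fun q => centralFourier φ lam p q) w‖ₑ ^ 2)

/-- The Hilbert–Schmidt norm of an operator with a square integrable kernel. -/
theorem hsNormSq_eq_lintegral_kernel {T : L2E d →L[ℂ] L2E d}
    {k : EuclideanSpace ℝ (Fin d) → EuclideanSpace ℝ (Fin d) → ℂ}
    (hkm : Measurable (Function.uncurry k)) (hk : ∫⁻ p, ∫⁻ y, ‖k p y‖ₑ ^ 2 ≠ ∞)
    (hT : ∀ f g : L2E d, inner ℂ g (T f) =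
      ∫ y, (∫ p, k p y * f (y - p)) * starRingEnd ℂ (g y)) :
    hsNormSq T = ∫⁻ p, ∫⁻ y, ‖k p y‖ₑ ^ 2 := by
  have hswap : ∫⁻ p, ∫⁻ y, ‖k p y‖ₑ ^ 2 = ∫⁻ y, ∫⁻ p, ‖k p y‖ₑ ^ 2 :=
    lintegral_lintegral_swap (hkm.enorm.pow_const 2).aemeasurable
  rw [hswap] at hk ⊢
  -- For almost every `y` the row of the kernel is square integrable, and substituting `z = y - p`
  -- turns the integral into the pairing of `f` with `κ(z) = conj (k (y - z) y)`.
  have hae : ∀ᵐ y, ∃ κ : L2E d, (‖κ‖ₑ ^ 2 = ∫⁻ p, ‖k p y‖ₑ ^ 2) ∧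
      ∀ f : L2E d, ∫ p, k p y * f (y - p) = inner ℂ κ f := by
    have hfin := ae_lt_top ((hkm.comp measurable_swap).enorm.pow_const 2).lintegral_prod_right' hk
    filter_upwards [hfin] with y hy
    have hm : Measurable fun z => starRingEnd ℂ (k (y - z) y) :=
      Complex.continuous_conj.measurable.comp
        (hkm.comp (by fun_prop : Measurable fun z => (y - z, y)))
    have hnorm : ∫⁻ z, ‖starRingEnd ℂ (k (y - z) y)‖ₑ ^ 2 = ∫⁻ p, ‖k p y‖ₑ ^ 2 := by
      simp only [RCLike.enorm_conj]
      exact lintegral_sub_left_eq_self (fun p => ‖k p y‖ₑ ^ 2) y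
    have hmem : MemLp (fun z => starRingEnd ℂ (k (y - z) y)) 2 volume := by
      refine ⟨hm.aestronglyMeasurable, lt_of_not_ge fun h => ?_⟩
      have hy' : ∫⁻ p, ‖k p y‖ₑ ^ 2 < ∞ := hy
      rw [← hnorm, lintegral_enorm_sq_eq_eLpNorm, top_le_iff.1 h] at hy'
      simp at hy'
    refine ⟨hmem.toLp _, ?_, fun f => ?_⟩
    · rw [← hnorm, ← lintegral_enorm_Lp_sq]
      refine lintegral_congr_ae ?_
      filter_upwards [hmem.coeFn_toLp] with z hz
      rw [hz]
    · rw [L2.inner_def, ← integral_sub_left_eq_self _ volume y]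
      refine integral_congr_ae ?_
      filter_upwards [hmem.coeFn_toLp] with z hz
      rw [hz, RCLike.inner_apply, Complex.conj_conj, sub_sub_cancel, mul_comm]
  have hhm : ∀ f : L2E d, Measurable fun y => ∫ p, k p y * f (y - p) := by
    intro f
    have : Measurable fun w : EuclideanSpace ℝ (Fin d) × EuclideanSpace ℝ (Fin d) =>
        k w.2 w.1 * f (w.1 - w.2) :=
      (hkm.comp measurable_swap).mul ((Lp_coeFn_measurable f).comp (by fun_prop))
    exact this.stronglyMeasurable.integral_prod_right'.measurable
  -- By Cauchy–Schwarz in each row, the squared norm is at most that of the kernel times `‖f‖²`.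
  have hhL : ∀ f : L2E d, MemLp (fun y => ∫ p, k p y * f (y - p)) 2 volume := by
    intro f
    refine ⟨(hhm f).aestronglyMeasurable, lt_of_not_ge fun h => ?_⟩
    have h1 : ∫⁻ y, ‖∫ p, k p y * f (y - p)‖ₑ ^ 2 ≤
        ∫⁻ y, (∫⁻ p, ‖k p y‖ₑ ^ 2) * ‖f‖ₑ ^ 2 := by
      refine lintegral_mono_ae ?_
      filter_upwards [hae] with y hy
      obtain ⟨κ, h2, h3⟩ := hy
      rw [h3, ← h2, ← mul_pow]
      gcongr
      simp only [← ofReal_norm]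
      rw [← ENNReal.ofReal_mul (norm_nonneg _)]
      exact ENNReal.ofReal_le_ofReal (norm_inner_le_norm κ f)
    rw [lintegral_mul_const' _ _ (by simp), lintegral_enorm_sq_eq_eLpNorm, top_le_iff.1 h] at h1
    have h4 : (∫⁻ y, ∫⁻ p, ‖k p y‖ₑ ^ 2) * ‖f‖ₑ ^ 2 < ∞ :=
      ENNReal.mul_lt_top hk.lt_top (by simp)
    simp only [ne_eq, OfNat.ofNat_ne_zero, not_false_eq_true, ENNReal.top_pow] at h1
    exact absurd h4 (not_lt.2 h1)
  have hTf : ∀ f : L2E d, T f = (hhL f).toLp _ := by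
    intro f
    refine ext_inner_left ℂ fun g => ?_
    rw [hT, L2.inner_def]
    refine integral_congr_ae ?_
    filter_upwards [(hhL f).coeFn_toLp] with y hy
    rw [hy, RCLike.inner_apply]
  have hTn : ∀ f : L2E d, ‖T f‖ₑ ^ 2 = ∫⁻ y, ‖∫ p, k p y * f (y - p)‖ₑ ^ 2 := by
    intro f
    rw [hTf, ← lintegral_enorm_Lp_sq]
    refine lintegral_congr_ae ?_
    filter_upwards [(hhL f).coeFn_toLp] with y hy
    rw [hy]
  simp only [hsNormSq, hTn]
  -- With the sum over the basis inside the integral, Parseval for `κ` computes it for each `y`.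
  rw [← lintegral_tsum fun i => ((hhm _).enorm.pow_const 2).aemeasurable]
  refine lintegral_congr_ae ?_
  filter_upwards [hae] with y hy
  obtain ⟨κ, h2, h3⟩ := hy
  simp only [h3, ← h2]
  rw [← tsum_enorm_inner_basis_sq (basis (L2E d)) κ]
  refine tsum_congr fun i => ?_
  rw [← inner_conj_symm, RCLike.enorm_conj]

theorem integral_norm_mul_le_eLpNorm_mul {α : Type*} [MeasurableSpace α] {μ : Measure α}
    {u v : α → ℂ} (hu : MemLp u 2 μ) (hv : MemLp v 2 μ) :
    ∫ y, ‖u y * v y‖ ∂μ ≤ (eLpNorm u 2 μ).toReal * (eLpNorm v 2 μ).toReal := by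
  have h1 : ∫ y, ‖u y * v y‖ ∂μ = inner ℝ (hu.norm.toLp _) (hv.norm.toLp _) := by
    rw [L2.inner_def]
    refine integral_congr_ae ?_
    filter_upwards [hu.norm.coeFn_toLp, hv.norm.coeFn_toLp] with y h2 h3
    rw [h2, h3, norm_mul, RCLike.inner_apply, conj_trivial, mul_comm]
  rw [h1, ← eLpNorm_norm u, ← eLpNorm_norm v, ← Lp.norm_toLp _ hu.norm, ← Lp.norm_toLp _ hv.norm]
  exact real_inner_le_norm _ _

theorem measurable_mul_schrodingerFun (φ : L2H d) (lam : ℝ) (f g : L2E d) :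
    Measurable fun w : Heisenberg d × EuclideanSpace ℝ (Fin d) =>
      φ w.1 * (schrodingerFun lam w.1 f w.2 * starRingEnd ℂ (g w.2)) := by
  have h : Measurable fun w : Heisenberg d × EuclideanSpace ℝ (Fin d) => ((lam, w.1), w.2) :=
    (measurable_const.prodMk measurable_fst).prodMk measurable_snd
  have h2 := (measurable_schrodingerFun f).comp h
  exact ((Lp_coeFn_measurable φ).comp measurable_fst).mul (h2.mul
    ((Complex.continuous_conj.measurable.comp (Lp_coeFn_measurable g)).comp measurable_snd))

/-- Cauchy–Schwarz in `y` bounds the inner integral by `‖f‖ ‖g‖` uniformly in `x`, and `φ` is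
integrable. This licenses the Fubini exchange that exposes the kernel. -/
theorem integrable_mul_schrodingerFun {φ : L2H d} (hφ : Integrable φ volume) (lam : ℝ)
    (f g : L2E d) : Integrable (fun w : Heisenberg d × EuclideanSpace ℝ (Fin d) =>
      φ w.1 * (schrodingerFun lam w.1 f w.2 * starRingEnd ℂ (g w.2)))
        ((volume : Measure (Heisenberg d)).prod volume) := by
  have hm := measurable_mul_schrodingerFun φ lam f g
  have hgm : MemLp (fun y => starRingEnd ℂ (g y)) 2 volume := (Lp.memLp g).star
  have hsm : ∀ x, MemLp (schrodingerFun lam x f) 2 volume := fun x => memLp_schrodingerFun lam x f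
  rw [integrable_prod_iff hm.aestronglyMeasurable]
  have hsi : ∀ x, Integrable fun y => schrodingerFun lam x f y * starRingEnd ℂ (g y) :=
    fun x => (hsm x).integrable_mul hgm
  refine ⟨ae_of_all _ fun x => (hsi x).const_mul (φ x), ?_⟩
  refine Integrable.mono' (hφ.norm.mul_const (‖f‖ * ‖g‖))
    (hm.stronglyMeasurable.norm.integral_prod_right'.aestronglyMeasurable)
    (ae_of_all _ fun x => ?_)
  rw [Real.norm_of_nonneg (integral_nonneg fun _ => norm_nonneg _)]
  simp only [norm_mul (φ x), integral_const_mul]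
  refine mul_le_mul_of_nonneg_left ?_ (norm_nonneg _)
  refine (integral_norm_mul_le_eLpNorm_mul (hsm x) hgm).trans (le_of_eq ?_)
  rw [← norm_schrodinger lam x f, schrodinger, Lp.norm_toLp, Lp.norm_def g]
  congr 2
  exact eLpNorm_congr_norm_ae (ae_of_all _ fun y => RCLike.norm_conj _)

theorem IsFourierIntegral.inner_eq_integral_kernel {φ : L2H d} (hφ : Integrable φ volume)
    {lam : ℝ} {T : L2E d →L[ℂ] L2E d} (hT : IsFourierIntegral φ lam T) (f g : L2E d) :
    inner ℂ g (T f) =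
      ∫ y, (∫ p, fourierKernel φ lam p y * f (y - p)) * starRingEnd ℂ (g y) := by
  have hint := integrable_mul_schrodingerFun hφ lam f g
  rw [hT f g]
  simp only [inner_schrodinger, ← integral_const_mul]
  rw [integral_integral_swap hint]
  refine integral_congr_ae ?_
  filter_upwards [hint.prod_left_ae] with y hy
  rw [← integral_mul_const]
  rw [integral_volume_prod hy]
  refine integral_congr_ae ?_
  filter_upwards [Integrable.prod_right_ae hy] with p hp
  rw [integral_volume_prod hp, fourierKernel, ← integral_mul_const, ← integral_mul_const]
  refine integral_congr_ae (ae_of_all _ fun q => ?_)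
  simp only [centralFourier, ← integral_mul_const]
  refine integral_congr_ae (ae_of_all _ fun t => ?_)
  simp only [schrodingerFun]
  ring

/-- Plancherel's theorem on the Heisenberg group for square integrable integrable functions. -/
theorem lintegral_hsNormSq_of_isFourierIntegral {φ : L2H d} (hφ : Integrable φ volume)
    {F : ℝ → L2E d →L[ℂ] L2E d} (hF : ∀ lam : ℝ, lam ≠ 0 → IsFourierIntegral φ lam (F lam)) :
    ∫⁻ lam, hsNormSq (F lam) * ENNReal.ofReal (|lam| ^ d) = ‖φ‖ₑ ^ 2 := by
  rw [← lintegral_enorm_centralFourier_sq hφ]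
  have hm : Measurable fun lam => ∫⁻ p, ∫⁻ q, ‖centralFourier φ lam p q‖ₑ ^ 2 :=
    (measurable_lintegral_centralFourier φ).lintegral_prod_right'
  have hfin := ae_lt_top hm (by rw [lintegral_enorm_centralFourier_sq hφ]; simp)
  refine lintegral_congr_ae ?_
  filter_upwards [hfin, Measure.ae_ne volume (0 : ℝ)] with lam h1 h2
  have hker := lintegral_enorm_fourierKernel_sq hφ h2 h1.ne
  rw [← hker]
  congr 1
  refine hsNormSq_eq_lintegral_kernel (measurable_fourierKernel φ lam) (fun h => ?_)
    ((hF lam h2).inner_eq_integral_kernel hφ)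
  rw [h, ENNReal.top_mul (ENNReal.ofReal_pos.2 (pow_pos (abs_pos.2 h2) d)).ne'] at hker
  exact h1.ne hker.symm

end PlancherelHeisenberg

/-! ### The scalar coefficient space and the Plancherel isometry. -/

section CoefficientSpace

/-- The index set of the matrix coefficients of operators on `L²(ℝ^d)`. -/
abbrev CoeffIndex (d : ℕ) : Type := basisIndex (L2E d) × basisIndex (L2E d)

variable {d : ℕ}

instance : MeasurableSpace (CoeffIndex d) := ⊤

instance : DiscreteMeasurableSpace (CoeffIndex d) := ⟨fun _ => trivial⟩

variable (d) in
/-- The measure on pairs of a frequency and a matrix index. -/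
def coeffMeasure : Measure (ℝ × CoeffIndex d) := (volume : Measure ℝ).prod Measure.count

/-- Only the empty set is null for counting measure, so exceptional sets live in the frequency
variable alone. -/
theorem ae_coeffMeasure_iff {P : ℝ × CoeffIndex d → Prop} :
    (∀ᵐ z ∂coeffMeasure d, P z) ↔ ∀ᵐ lam : ℝ, ∀ q, P (lam, q) := by
  constructor
  · intro h
    filter_upwards [Measure.ae_ae_of_ae_prod h] with lam hlam
    exact Measure.ae_count_iff.1 hlam
  · intro h
    filter_upwards [Measure.quasiMeasurePreserving_fst.ae h] with z hz
    exact hz z.2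

theorem aemeasurable_coeffMeasure {β : Type*} [MeasurableSpace β] {f : ℝ × CoeffIndex d → β}
    (hf : ∀ q, AEMeasurable (fun lam => f (lam, q)) volume) : AEMeasurable f (coeffMeasure d) := by
  refine ⟨fun z => (hf z.2).mk _ z.1, measurable_from_prod_countable_left fun q =>
    (hf q).measurable_mk, ?_⟩
  refine ae_coeffMeasure_iff.2 (ae_all_iff.2 fun q => (hf q).ae_eq_mk)

theorem lintegral_coeffMeasure {f : ℝ × CoeffIndex d → ℝ≥0∞}
    (hf : AEMeasurable f (coeffMeasure d)) :
    ∫⁻ z, f z ∂coeffMeasure d = ∫⁻ lam, ∑' q, f (lam, q) := by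
  rw [coeffMeasure, lintegral_prod _ hf]
  simp only [lintegral_count]

/-- The matrix coefficients of an operator valued function, scaled by the square root of the
Plancherel density. -/
def coeffFun (F : ℝ → L2E d →L[ℂ] L2E d) (z : ℝ × CoeffIndex d) : ℂ :=
  (√(|z.1| ^ d) : ℝ) * matrixCoeff (F z.1) z.2

theorem enorm_sqrt_sq (r : ℝ) (hr : 0 ≤ r) : ‖((√r : ℝ) : ℂ)‖ₑ ^ 2 = ENNReal.ofReal r := by
  rw [← ofReal_norm, ← ENNReal.ofReal_pow (norm_nonneg _), Complex.norm_real, Real.norm_eq_abs,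
    sq_abs, Real.sq_sqrt hr]

theorem tsum_enorm_coeffFun_sq (F : ℝ → L2E d →L[ℂ] L2E d) (lam : ℝ) :
    ∑' q, ‖coeffFun F (lam, q)‖ₑ ^ 2 = hsNormSq (F lam) * ENNReal.ofReal (|lam| ^ d) := by
  simp only [coeffFun, enorm_mul, mul_pow, enorm_sqrt_sq _ (pow_nonneg (abs_nonneg lam) d)]
  rw [ENNReal.tsum_mul_left, mul_comm, hsNormSq_eq_tsum_matrixCoeff]

theorem aemeasurable_coeffFun {F : ℝ → L2E d →L[ℂ] L2E d}
    (hF : ∀ f g : L2E d, AEMeasurable (fun lam => inner ℂ g (F lam f)) volume) :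
    AEMeasurable (coeffFun F) (coeffMeasure d) := by
  have h1 : Measurable fun lam : ℝ => ((√(|lam| ^ d) : ℝ) : ℂ) :=
    Continuous.measurable (by fun_prop)
  refine aemeasurable_coeffMeasure fun q => ?_
  have h2 : AEMeasurable (fun lam => matrixCoeff (F lam) q) volume := hF _ _
  exact h1.aemeasurable.mul h2

theorem lintegral_enorm_coeffFun_sq {F : ℝ → L2E d →L[ℂ] L2E d}
    (hF : ∀ f g : L2E d, AEMeasurable (fun lam => inner ℂ g (F lam f)) volume) :
    ∫⁻ z, ‖coeffFun F z‖ₑ ^ 2 ∂coeffMeasure d =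
      ∫⁻ lam, hsNormSq (F lam) * ENNReal.ofReal (|lam| ^ d) := by
  rw [lintegral_coeffMeasure ((aemeasurable_coeffFun hF).enorm.pow_const 2)]
  simp only [tsum_enorm_coeffFun_sq]

theorem eLpNorm_coeffFun_of_isFourierIntegral {φ : L2H d} (hφ : Integrable φ volume)
    {F : ℝ → L2E d →L[ℂ] L2E d} (hF : ∀ lam : ℝ, lam ≠ 0 → IsFourierIntegral φ lam (F lam)) :
    eLpNorm (coeffFun F) 2 (coeffMeasure d) = ‖φ‖ₑ := by
  have h := lintegral_enorm_coeffFun_sq (aemeasurable_inner_of_isFourierIntegral hF)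
  rw [lintegral_hsNormSq_of_isFourierIntegral hφ hF, lintegral_enorm_sq_eq_eLpNorm] at h
  exact (ENNReal.pow_right_strictMono two_ne_zero).injective h

theorem memLp_coeffFun_of_isFourierIntegral {φ : L2H d} (hφ : Integrable φ volume)
    {F : ℝ → L2E d →L[ℂ] L2E d} (hF : ∀ lam : ℝ, lam ≠ 0 → IsFourierIntegral φ lam (F lam)) :
    MemLp (coeffFun F) 2 (coeffMeasure d) := by
  refine ⟨(aemeasurable_coeffFun
    (aemeasurable_inner_of_isFourierIntegral hF)).aestronglyMeasurable, ?_⟩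
  rw [eLpNorm_coeffFun_of_isFourierIntegral hφ hF]
  exact enorm_lt_top

variable (d) in
/-- The subspace `L¹ ∩ L²` of `L²(ℍ^d)`. -/
def integrableSubmodule : Submodule ℂ (L2H d) where
  carrier := {φ | Integrable φ volume}
  add_mem' {φ φ'} h h' := (integrable_congr (Lp.coeFn_add φ φ')).2 (h.add h')
  zero_mem' := (integrable_congr (Lp.coeFn_zero ℂ 2 volume)).2 (integrable_zero _ _ _)
  smul_mem' c φ h := (integrable_congr (Lp.coeFn_smul c φ)).2 (h.smul c)

/-- Simple functions are dense in `L²`, and a square integrable simple function is integrable. -/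
theorem denseRange_integrableSubmodule :
    DenseRange (integrableSubmodule d).subtype := by
  have h := Lp.simpleFunc.denseRange (E := ℂ) (μ := (volume : Measure (Heisenberg d)))
    (p := 2) ENNReal.ofNat_ne_top
  refine h.mono ?_
  rintro _ ⟨s, rfl⟩
  refine ⟨⟨s, ?_⟩, rfl⟩
  have h1 := Lp.simpleFunc.toSimpleFunc_eq_toFun s
  refine (integrable_congr h1).1 ?_
  exact (SimpleFunc.memLp_iff_integrable two_ne_zero ENNReal.ofNat_ne_top).1
    (Lp.simpleFunc.memLp s)

/-- The Fourier transform of an element of `L¹ ∩ L²`, given by the weak operator integral. -/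
def fourierL1 (φ : integrableSubmodule d) (lam : ℝ) : L2E d →L[ℂ] L2E d :=
  (exists_isFourierIntegral φ.2 lam).choose

theorem isFourierIntegral_fourierL1 (φ : integrableSubmodule d) (lam : ℝ) :
    IsFourierIntegral φ.1 lam (fourierL1 φ lam) :=
  (exists_isFourierIntegral φ.2 lam).choose_spec

theorem fourierL1_add (φ φ' : integrableSubmodule d) (lam : ℝ) :
    fourierL1 (φ + φ') lam = fourierL1 φ lam + fourierL1 φ' lam :=
  (isFourierIntegral_fourierL1 _ lam).unique
    ((isFourierIntegral_fourierL1 φ lam).add φ.2 φ'.2 (isFourierIntegral_fourierL1 φ' lam))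

theorem fourierL1_smul (c : ℂ) (φ : integrableSubmodule d) (lam : ℝ) :
    fourierL1 (c • φ) lam = c • fourierL1 φ lam :=
  (isFourierIntegral_fourierL1 _ lam).unique ((isFourierIntegral_fourierL1 φ lam).smul c)

theorem memLp_coeffFun_fourierL1 (φ : integrableSubmodule d) :
    MemLp (coeffFun (fourierL1 φ)) 2 (coeffMeasure d) :=
  memLp_coeffFun_of_isFourierIntegral φ.2 fun lam _ => isFourierIntegral_fourierL1 φ lam

variable (d) in
/-- The coefficients of the Fourier transform on `L¹ ∩ L²`. -/
def plancherelL1 : integrableSubmodule d →ₗ[ℂ] Lp ℂ 2 (coeffMeasure d) where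
  toFun φ := (memLp_coeffFun_fourierL1 φ).toLp _
  map_add' φ φ' := by
    rw [← MemLp.toLp_add]
    refine MemLp.toLp_congr _ _ (ae_of_all _ fun z => ?_)
    change coeffFun _ z = coeffFun _ z + coeffFun _ z
    rw [coeffFun, coeffFun, coeffFun, fourierL1_add, matrixCoeff_add, mul_add]
  map_smul' c φ := by
    rw [RingHom.id_apply, ← MemLp.toLp_const_smul]
    refine MemLp.toLp_congr _ _ (ae_of_all _ fun z => ?_)
    change coeffFun _ z = c * coeffFun _ z
    rw [coeffFun, coeffFun, fourierL1_smul, matrixCoeff_smul, mul_left_comm]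

theorem norm_plancherelL1 (φ : integrableSubmodule d) : ‖plancherelL1 d φ‖ = ‖φ‖ := by
  change ‖(memLp_coeffFun_fourierL1 φ).toLp _‖ = ‖(φ : L2H d)‖
  rw [Lp.norm_toLp, eLpNorm_coeffFun_of_isFourierIntegral φ.2
    fun lam _ => isFourierIntegral_fourierL1 φ lam, toReal_enorm]

theorem exists_plancherel_bound :
    ∃ C, ∀ φ, ‖plancherelL1 d φ‖ ≤ C * ‖(integrableSubmodule d).subtype φ‖ :=
  ⟨1, fun φ => by rw [norm_plancherelL1, one_mul]; rfl⟩

theorem extendOfNorm_plancherelL1 (φ : integrableSubmodule d) :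
    (plancherelL1 d).extendOfNorm (integrableSubmodule d).subtype φ = plancherelL1 d φ :=
  LinearMap.extendOfNorm_eq denseRange_integrableSubmodule exists_plancherel_bound φ

variable (d) in
/-- The coefficients of the Fourier transform on `L²(ℍ^d)`. -/
def plancherelMap : L2H d →ₗᵢ[ℂ] Lp ℂ 2 (coeffMeasure d) where
  toLinearMap := ((plancherelL1 d).extendOfNorm (integrableSubmodule d).subtype).toLinearMap
  norm_map' φ := by
    -- Norm preservation is a closed condition and holds on `L¹ ∩ L²`.
    refine DenseRange.induction_on denseRange_integrableSubmodule φ ?_ fun φ' => ?_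
    · exact isClosed_eq (ContinuousLinearMap.continuous _).norm continuous_norm
    · exact (congrArg norm (extendOfNorm_plancherelL1 φ')).trans (norm_plancherelL1 φ')

theorem plancherelMap_ae_eq_of_isFourierIntegral {φ : L2H d} (hφ : Integrable φ volume)
    {F : ℝ → L2E d →L[ℂ] L2E d} (hF : ∀ lam : ℝ, lam ≠ 0 → IsFourierIntegral φ lam (F lam)) :
    plancherelMap d φ =ᵐ[coeffMeasure d] coeffFun F := by
  have h1 : plancherelMap d φ = plancherelL1 d ⟨φ, hφ⟩ := extendOfNorm_plancherelL1 ⟨φ, hφ⟩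
  rw [h1]
  refine (MemLp.coeFn_toLp (memLp_coeffFun_fourierL1 ⟨φ, hφ⟩)).trans (ae_coeffMeasure_iff.2 ?_)
  filter_upwards [Measure.ae_ne volume (0 : ℝ)] with lam hlam q
  simp only [coeffFun]
  rw [(isFourierIntegral_fourierL1 ⟨φ, hφ⟩ lam).unique (hF lam hlam)]

end CoefficientSpace

/-! ### Existence and almost everywhere uniqueness of the Fourier transform on `L²`. -/

section FourierTransform

variable {d : ℕ}

theorem coeffFun_sub (F G : ℝ → L2E d →L[ℂ] L2E d) :
    coeffFun (fun lam => F lam - G lam) = coeffFun F - coeffFun G := by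
  funext z
  rw [Pi.sub_apply, coeffFun, coeffFun, coeffFun, matrixCoeff_sub, mul_sub]

theorem eLpNorm_coeffFun_sub_sq {F G : ℝ → L2E d →L[ℂ] L2E d}
    (hF : ∀ f g : L2E d, AEMeasurable (fun lam => inner ℂ g (F lam f)) volume)
    (hG : ∀ f g : L2E d, AEMeasurable (fun lam => inner ℂ g (G lam f)) volume) :
    eLpNorm (coeffFun F - coeffFun G) 2 (coeffMeasure d) ^ 2 =
      ∫⁻ lam, hsNormSq (F lam - G lam) * ENNReal.ofReal (|lam| ^ d) := by
  have h : ∀ f g : L2E d, AEMeasurable (fun lam => inner ℂ g ((F lam - G lam) f)) volume := by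
    intro f g
    simp only [sub_apply, inner_sub_right]
    exact (hF f g).sub (hG f g)
  rw [← lintegral_enorm_coeffFun_sq h, coeffFun_sub, lintegral_enorm_sq_eq_eLpNorm]

theorem ENNReal_tendsto_zero_of_sq {ι : Type*} {l : Filter ι} {u : ι → ℝ≥0∞}
    (h : Tendsto (fun n => u n ^ 2) l (𝓝 0)) : Tendsto u l (𝓝 0) := by
  have h2 := (ENNReal.continuous_rpow_const (y := 1 / 2)).tendsto 0 |>.comp h
  rw [ENNReal.zero_rpow_of_pos (by norm_num)] at h2
  refine h2.congr fun n => ?_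
  simp only [Function.comp_apply]
  rw [← ENNReal.rpow_natCast, ← ENNReal.rpow_mul]
  norm_num

/-- The coefficients of the approximating transforms converge both to those of `F` and to
`plancherelMap d φ`. Hence every version of the transform has the same coefficients almost
everywhere, and the choice made in `fourier` is harmless. -/
theorem IsFourierTransform.plancherelMap_ae_eq {φ : L2H d} {F : ℝ → L2E d →L[ℂ] L2E d}
    (h : IsFourierTransform φ F) : plancherelMap d φ =ᵐ[coeffMeasure d] coeffFun F := by
  obtain ⟨hm, φs, Fs, hint, hFs, hφs, hlim⟩ := h
  have h1 : Tendsto (fun n => eLpNorm (coeffFun (Fs n) - coeffFun F) 2 (coeffMeasure d)) atTop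
      (𝓝 0) := by
    refine ENNReal_tendsto_zero_of_sq (hlim.congr fun n => ?_)
    exact (eLpNorm_coeffFun_sub_sq (aemeasurable_inner_of_isFourierIntegral (hFs n)) hm).symm
  have h2 := (Lp.tendsto_Lp_iff_tendsto_eLpNorm' _ _).1
    (((plancherelMap d).continuous.tendsto φ).comp hφs)
  have hcm := (aemeasurable_coeffFun hm).aestronglyMeasurable
  have h3 : ∀ n, eLpNorm (⇑(plancherelMap d φ) - coeffFun F) 2 (coeffMeasure d) ≤
      eLpNorm (⇑(plancherelMap d (φs n)) - ⇑(plancherelMap d φ)) 2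
        (coeffMeasure d) + eLpNorm (coeffFun (Fs n) - coeffFun F) 2 (coeffMeasure d) := by
    intro n
    have h4 := plancherelMap_ae_eq_of_isFourierIntegral (hint n) (hFs n)
    have h5 : eLpNorm (coeffFun (Fs n) - coeffFun F) 2 (coeffMeasure d) =
        eLpNorm (⇑(plancherelMap d (φs n)) - coeffFun F) 2 (coeffMeasure d) :=
      eLpNorm_congr_ae (h4.symm.sub (ae_eq_refl _))
    rw [h5, eLpNorm_sub_comm (plancherelMap d (φs n) : ℝ × CoeffIndex d → ℂ)
      (plancherelMap d φ)]
    refine le_trans (le_of_eq ?_) (eLpNorm_add_le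
      ((Lp.aestronglyMeasurable _).sub (Lp.aestronglyMeasurable _))
      ((Lp.aestronglyMeasurable _).sub hcm) one_le_two)
    rw [sub_add_sub_cancel]
  have h6 := h2.add h1
  rw [add_zero] at h6
  have h7 : eLpNorm (⇑(plancherelMap d φ) - coeffFun F) 2 (coeffMeasure d) = 0 :=
    le_antisymm (ge_of_tendsto' h6 h3) zero_le
  rw [eLpNorm_eq_zero_iff ((Lp.aestronglyMeasurable _).sub hcm) two_ne_zero] at h7
  filter_upwards [h7] with z hz
  exact sub_eq_zero.1 hz

/-- For almost every `λ` the section of `u` is square summable and `λ ≠ 0`, so dividing by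
`√(|λ|^d)` leaves a Hilbert–Schmidt matrix. Elsewhere the operator is irrelevant. -/
theorem exists_coeffFun_ae_eq (u : Lp ℂ 2 (coeffMeasure d)) :
    ∃ F : ℝ → L2E d →L[ℂ] L2E d,
      (∀ f g : L2E d, AEMeasurable (fun lam => inner ℂ g (F lam f)) volume) ∧
      u =ᵐ[coeffMeasure d] coeffFun F := by
  have hum := Lp_coeFn_measurable u
  have hfin : ∀ᵐ lam : ℝ, ∑' q, ‖u (lam, q)‖ₑ ^ 2 < ∞ := by
    refine ae_lt_top (Measurable.tsum fun q =>
      (hum.comp measurable_prodMk_right).enorm.pow_const 2) ?_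
    rw [← lintegral_coeffMeasure (hum.enorm.pow_const 2).aemeasurable, lintegral_enorm_Lp_sq]
    simp
  have hex : ∀ lam : ℝ, ∃ T : L2E d →L[ℂ] L2E d, lam ≠ 0 → ∑' q, ‖u (lam, q)‖ₑ ^ 2 < ∞ →
      ∀ q, matrixCoeff T q = u (lam, q) * ((√(|lam| ^ d) : ℝ) : ℂ)⁻¹ := by
    intro lam
    by_cases h : ∑' q, ‖u (lam, q)‖ₑ ^ 2 < ∞
    · obtain ⟨T, hT⟩ := exists_matrixCoeff_eq (H := L2E d)
        (a := fun q => u (lam, q) * ((√(|lam| ^ d) : ℝ) : ℂ)⁻¹) (by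
          simp only [enorm_mul, mul_pow]
          rw [ENNReal.tsum_mul_right]
          exact ENNReal.mul_ne_top h.ne (by simp))
      exact ⟨T, fun _ _ => hT⟩
    · exact ⟨0, fun _ h' => absurd h' h⟩
  choose F hF using hex
  have hc : ∀ᵐ lam : ℝ, ∀ q, matrixCoeff (F lam) q =
      u (lam, q) * ((√(|lam| ^ d) : ℝ) : ℂ)⁻¹ := by
    filter_upwards [hfin, Measure.ae_ne volume (0 : ℝ)] with lam h1 h2
    exact hF lam h2 h1
  refine ⟨F, aemeasurable_inner_of_matrixCoeff fun q => ?_, ae_coeffMeasure_iff.2 ?_⟩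
  · have h1 : Measurable fun lam : ℝ => ((√(|lam| ^ d) : ℝ) : ℂ) :=
      Continuous.measurable (by fun_prop)
    have h2 : Measurable fun lam : ℝ => u (lam, q) := hum.comp measurable_prodMk_right
    refine ⟨_, h2.mul h1.inv, ?_⟩
    filter_upwards [hc] with lam hlam
    exact hlam q
  · filter_upwards [hc, Measure.ae_ne volume (0 : ℝ)] with lam h1 h2 q
    have h3 : ((√(|lam| ^ d) : ℝ) : ℂ) ≠ 0 := by
      exact_mod_cast (Real.sqrt_pos.2 (pow_pos (abs_pos.2 h2) d)).ne'
    rw [coeffFun, h1, mul_comm, mul_assoc, inv_mul_cancel₀ h3, mul_one]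

theorem exists_isFourierTransform (φ : L2H d) : ∃ F, IsFourierTransform φ F := by
  obtain ⟨F, hm, hF⟩ := exists_coeffFun_ae_eq (plancherelMap d φ)
  obtain ⟨φs, hφs, hlim⟩ := mem_closure_iff_seq_limit.1 (denseRange_integrableSubmodule φ)
  choose φs' hφs' using hφs
  obtain rfl : (fun n => (φs' n : L2H d)) = φs := funext hφs'
  refine ⟨F, hm, fun n => φs' n, fun n => fourierL1 (φs' n), fun n => (φs' n).2,
    fun n lam _ => isFourierIntegral_fourierL1 _ lam, hlim, ?_⟩
  have h2 := (Lp.tendsto_Lp_iff_tendsto_eLpNorm' _ _).1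
    (((plancherelMap d).continuous.tendsto φ).comp hlim)
  have h3 := ((ENNReal.continuous_pow 2).tendsto 0).comp h2
  rw [zero_pow two_ne_zero] at h3
  refine h3.congr fun n => ?_
  have h4 : ∀ lam : ℝ, lam ≠ 0 → IsFourierIntegral (φs' n : L2H d) lam (fourierL1 (φs' n) lam) :=
    fun lam _ => isFourierIntegral_fourierL1 _ lam
  rw [← eLpNorm_coeffFun_sub_sq (aemeasurable_inner_of_isFourierIntegral h4) hm]
  exact congrArg (· ^ 2) (eLpNorm_congr_ae
    ((plancherelMap_ae_eq_of_isFourierIntegral (φs' n).2 h4).sub hF))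

theorem isFourierTransform_fourier (φ : L2H d) : IsFourierTransform φ (fourier φ) := by
  rw [fourier, dif_pos (exists_isFourierTransform φ)]
  exact (exists_isFourierTransform φ).choose_spec

theorem plancherelMap_ae_eq_fourier (φ : L2H d) :
    plancherelMap d φ =ᵐ[coeffMeasure d] coeffFun (fourier φ) :=
  (isFourierTransform_fourier φ).plancherelMap_ae_eq

/-- The Hilbert–Schmidt norm squared times `|λ|^d` is integrable, and the density vanishes at most
at `0`. The finiteness justifies expanding `hsInner` in coefficients. -/
theorem hsNormSq_fourier_ne_top (φ : L2H d) : ∀ᵐ lam : ℝ, hsNormSq (fourier φ lam) ≠ ∞ := by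
  have hm := (isFourierTransform_fourier φ).1
  have hc := (aemeasurable_coeffFun hm).enorm.pow_const 2
  have h1 : ∫⁻ lam, ∑' q, ‖coeffFun (fourier φ) (lam, q)‖ₑ ^ 2 ≠ ∞ := by
    rw [← lintegral_coeffMeasure hc, lintegral_enorm_sq_eq_eLpNorm,
      ← eLpNorm_congr_ae (plancherelMap_ae_eq_fourier φ)]
    exact ENNReal.pow_ne_top (Lp.eLpNorm_ne_top _)
  have h2 : AEMeasurable (fun lam => ∑' q, ‖coeffFun (fourier φ) (lam, q)‖ₑ ^ 2) volume := by
    refine AEMeasurable.tsum fun q => AEMeasurable.pow_const (AEMeasurable.enorm ?_) 2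
    have h1 : Measurable fun lam : ℝ => ((√(|lam| ^ d) : ℝ) : ℂ) :=
      Continuous.measurable (by fun_prop)
    have h2 : AEMeasurable (fun lam => matrixCoeff (fourier φ lam) q) volume := hm _ _
    exact h1.aemeasurable.mul h2
  filter_upwards [ae_lt_top' h2 h1, Measure.ae_ne volume (0 : ℝ)] with lam h3 h4 h5
  rw [tsum_enorm_coeffFun_sq, h5,
    ENNReal.top_mul (ENNReal.ofReal_pos.2 (pow_pos (abs_pos.2 h4) d)).ne'] at h3
  exact lt_irrefl _ h3

/-! ### Central translations -/

theorem coeFn_leftTranslation (g : Heisenberg d) (φ : L2H d) :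
    leftTranslation g φ =ᵐ[volume] fun x => φ (g⁻¹ * x) :=
  Lp.coeFn_compMeasurePreserving _ _

theorem continuous_leftTranslation (g : Heisenberg d) :
    Continuous (leftTranslation g : L2H d → L2H d) :=
  (Lp.isometry_compMeasurePreserving (measurePreserving_mul_left g⁻¹)).continuous

theorem integrable_leftTranslation (g : Heisenberg d) {φ : L2H d} (hφ : Integrable φ volume) :
    Integrable (leftTranslation g φ) volume :=
  (integrable_congr (coeFn_leftTranslation g φ)).2
    ((measurePreserving_mul_left g⁻¹).integrable_comp_of_integrable hφ)

theorem schrodinger_central_mul (lam t : ℝ) (x : Heisenberg d) (f : L2E d) :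
    schrodinger lam (central d t * x) f =
      Complex.exp ((2 * Real.pi * lam * t : ℝ) * Complex.I) • schrodinger lam x f := by
  refine Lp.ext ?_
  filter_upwards [coeFn_schrodinger lam (central d t * x) f, coeFn_schrodinger lam x f,
    Lp.coeFn_smul (Complex.exp ((2 * Real.pi * lam * t : ℝ) * Complex.I))
      (schrodinger lam x f)] with y h1 h2 h3
  rw [h1, h3, Pi.smul_apply, h2]
  simp only [schrodingerFun, mul_def, central, zero_add, inner_zero_left, add_zero, smul_eq_mul]
  have h4 : ((2 * Real.pi * lam * (t + x.2.2) : ℝ) : ℂ) * Complex.I =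
      (2 * Real.pi * lam * t : ℝ) * Complex.I + (2 * Real.pi * lam * x.2.2 : ℝ) * Complex.I := by
    push_cast
    ring
  rw [h4, Complex.exp_add]
  ring

/-- Substituting `x ↦ (0,0,t)x`, which preserves the measure, moves the translation onto the
representation, where the central element acts by a scalar. -/
theorem IsFourierIntegral.leftTranslation_central {φ : L2H d} {lam : ℝ}
    {T : L2E d →L[ℂ] L2E d} (hT : IsFourierIntegral φ lam T) (t : ℝ) :
    IsFourierIntegral (leftTranslation (central d t) φ) lam
      (Complex.exp ((2 * Real.pi * lam * t : ℝ) * Complex.I) • T) := by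
  intro f g
  have h1 : ∫ x, leftTranslation (central d t) φ x * inner ℂ g (schrodinger lam x f) =
      ∫ x, φ ((central d t)⁻¹ * x) * inner ℂ g (schrodinger lam x f) := by
    refine integral_congr_ae ?_
    filter_upwards [coeFn_leftTranslation (central d t) φ] with x hx
    rw [hx]
  have hc : Continuous fun x : Heisenberg d => central d t * x := by
    simp only [mul_def]
    fun_prop
  have hc' : Continuous fun x : Heisenberg d => (central d t)⁻¹ * x := by
    simp only [mul_def]
    fun_prop
  let e : Heisenberg d ≃ₜ Heisenberg d :=
    { toFun := fun x => central d t * x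
      invFun := fun x => (central d t)⁻¹ * x
      left_inv := fun x => inv_mul_cancel_left _ x
      right_inv := fun x => mul_inv_cancel_left _ x
      continuous_toFun := hc
      continuous_invFun := hc' }
  have h2 := (measurePreserving_mul_left (central d t)).integral_comp e.measurableEmbedding
    (fun x => φ ((central d t)⁻¹ * x) * inner ℂ g (schrodinger lam x f))
  rw [h1, ← h2, smul_apply, inner_smul_right, hT f g, ← integral_const_mul]
  refine integral_congr_ae (ae_of_all _ fun x => ?_)
  simp only [inv_mul_cancel_left, schrodinger_central_mul, inner_smul_right]
  ring

theorem hsNormSq_smul_of_norm_eq_one {H : Type*} [NormedAddCommGroup H] [InnerProductSpace ℂ H]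
    [CompleteSpace H] {c : ℂ} (hc : ‖c‖ = 1) (A : H →L[ℂ] H) : hsNormSq (c • A) = hsNormSq A := by
  have h : ‖c‖ₑ = 1 := by rw [← ofReal_norm, hc, ENNReal.ofReal_one]
  simp only [hsNormSq, smul_apply, enorm_smul, h, one_mul]

/-- Translating the approximating sequence works because the phases have modulus one and leave all
Hilbert–Schmidt norms unchanged. -/
theorem IsFourierTransform.leftTranslation_central {φ : L2H d} {F : ℝ → L2E d →L[ℂ] L2E d}
    (h : IsFourierTransform φ F) (t : ℝ) :
    IsFourierTransform (leftTranslation (central d t) φ) fun lam =>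
      Complex.exp ((2 * Real.pi * lam * t : ℝ) * Complex.I) • F lam := by
  obtain ⟨hm, φs, Fs, hint, hFs, hφs, hlim⟩ := h
  refine ⟨fun f g => ?_, fun n => leftTranslation (central d t) (φs n), fun n lam =>
    Complex.exp ((2 * Real.pi * lam * t : ℝ) * Complex.I) • Fs n lam,
    fun n => integrable_leftTranslation _ (hint n),
    fun n lam hlam => (hFs n lam hlam).leftTranslation_central t,
    ((continuous_leftTranslation _).tendsto φ).comp hφs, ?_⟩
  · simp only [smul_apply, inner_smul_right]
    have h1 : Continuous fun lam : ℝ =>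
        Complex.exp ((2 * Real.pi * lam * t : ℝ) * Complex.I) := by fun_prop
    exact h1.measurable.aemeasurable.mul (hm f g)
  · simpa only [← smul_sub, hsNormSq_smul_of_norm_eq_one (Complex.norm_exp_ofReal_mul_I _)]
      using hlim

theorem plancherelMap_leftTranslation_central (φ : L2H d) (t : ℝ) :
    plancherelMap d (leftTranslation (central d t) φ) =ᵐ[coeffMeasure d] fun z =>
      Complex.exp ((2 * Real.pi * z.1 * t : ℝ) * Complex.I) * coeffFun (fourier φ) z := by
  refine ((isFourierTransform_fourier φ).leftTranslation_central t).plancherelMap_ae_eq.trans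
    (ae_of_all _ fun z => ?_)
  simp only [coeffFun, matrixCoeff_smul]
  ring

end FourierTransform

/-! ### Abstract isometries: matching total families, and multiplication operators. -/

section Isometries

/-- Two isometries that match the generators of a closed span with a total family identify the
closed span with the whole space. -/
theorem exists_linearIsometryEquiv_of_total {H₁ H₂ H₃ ι : Type*}
    [NormedAddCommGroup H₁] [NormedSpace ℂ H₁] [CompleteSpace H₁]
    [NormedAddCommGroup H₂] [NormedSpace ℂ H₂] [CompleteSpace H₂]
    [NormedAddCommGroup H₃] [NormedSpace ℂ H₃]
    (U : H₁ →ₗᵢ[ℂ] H₃) (V : H₂ →ₗᵢ[ℂ] H₃) (a : ι → H₁) (b : ι → H₂)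
    (hab : ∀ k, U (a k) = V (b k))
    (hb : (Submodule.span ℂ (range b)).topologicalClosure = ⊤) :
    ∃ S : (Submodule.span ℂ (range a)).topologicalClosure ≃ₗᵢ[ℂ] H₂,
      ∀ x, V (S x) = U x := by
  set K := (Submodule.span ℂ (range a)).topologicalClosure with hK
  have hKc : IsClosed (K : Set H₁) := Submodule.isClosed_topologicalClosure _
  -- The range of an isometry on a complete space is closed, so containing the generators is enough.
  have h1 : K ≤ (LinearMap.range V.toLinearMap).comap U.toLinearMap := by
    refine Submodule.topologicalClosure_minimal _ (Submodule.span_le.2 ?_) ?_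
    · rintro _ ⟨k, rfl⟩
      exact ⟨b k, (hab k).symm⟩
    · exact V.isometry.isClosedEmbedding.isClosed_range.preimage U.continuous
  -- Conversely `U(K)` is closed and contains every `V (b k)`, so totality of `b` puts the whole
  -- range of `V` inside it.
  have h2 : ⊤ ≤ (K.map U.toLinearMap).comap V.toLinearMap := by
    rw [← hb]
    refine Submodule.topologicalClosure_minimal _ (Submodule.span_le.2 ?_) ?_
    · rintro _ ⟨k, rfl⟩
      exact ⟨a k, Submodule.le_topologicalClosure _ (Submodule.subset_span ⟨k, rfl⟩), hab k⟩
    · exact (U.isometry.isClosedEmbedding.isClosedMap _ hKc).preimage V.continuous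
  let T : K →ₗᵢ[ℂ] LinearMap.range V.toLinearMap :=
    { toLinearMap := (U.toLinearMap ∘ₗ K.subtype).codRestrict _ fun x => h1 x.2
      norm_map' := fun x => U.norm_map x }
  have hsurj : Function.Surjective (V.equivRange.symm.toLinearIsometry.comp T) := by
    intro y
    obtain ⟨x, hx, hxy⟩ := h2 (Submodule.mem_top : y ∈ ⊤)
    refine ⟨⟨x, hx⟩, ?_⟩
    apply V.equivRange.injective
    refine (V.equivRange.apply_symm_apply _).trans (Subtype.ext ?_)
    exact hxy
  refine ⟨LinearIsometryEquiv.ofSurjective _ hsurj, fun x => ?_⟩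
  exact congrArg Subtype.val (V.equivRange.apply_symm_apply (T x))

theorem lintegral_map_withDensity_enorm_sq {X Y : Type*} [MeasurableSpace X] [MeasurableSpace Y]
    {ν : Measure X} {μ : Measure Y} {u : X → ℂ} (hu : Measurable u) {π : X → Y}
    (hπ : Measurable π) (hμ : (ν.withDensity fun x => ‖u x‖ₑ ^ 2).map π = μ) {h : Y → ℝ≥0∞}
    (hh : Measurable h) : ∫⁻ x, h (π x) * ‖u x‖ₑ ^ 2 ∂ν = ∫⁻ y, h y ∂μ := by
  rw [← hμ, lintegral_map hh hπ]
  refine Eq.symm ((lintegral_withDensity_eq_lintegral_mul _ (hu.enorm.pow_const 2)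
    (hh.comp hπ)).trans ?_)
  exact lintegral_congr fun x => mul_comm _ _

/-- The values of `m ∘ π` are controlled only where `u ≠ 0`; where `u = 0` both products vanish.
Multiplication by `u` is thus well defined on classes modulo `μ`. -/
theorem ae_mul_eq_of_ae_map_withDensity {X Y : Type*} [MeasurableSpace X] [MeasurableSpace Y]
    {ν : Measure X} {μ : Measure Y} {u : X → ℂ} (hu : Measurable u) {π : X → Y}
    (hπ : Measurable π) (hμ : (ν.withDensity fun x => ‖u x‖ₑ ^ 2).map π = μ) {m m' : Y → ℂ}
    (h : m =ᵐ[μ] m') : ∀ᵐ x ∂ν, m (π x) * u x = m' (π x) * u x := by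
  rw [← hμ] at h
  have h2 := ae_of_ae_map hπ.aemeasurable h
  rw [ae_withDensity_iff (hu.enorm.pow_const 2)] at h2
  filter_upwards [h2] with x hx
  by_cases h0 : u x = 0
  · simp [h0]
  · rw [hx (by simpa using h0)]

/-- Multiplication by `u`, after composition with `π`, is an isometry from the `L²` space of the
image under `π` of the measure `|u|² dν`. -/
theorem exists_linearIsometry_comp_mul {X Y : Type*} [MeasurableSpace X] [MeasurableSpace Y]
    {ν : Measure X} {μ : Measure Y} {u : X → ℂ} (hu : Measurable u) {π : X → Y}
    (hπ : Measurable π) (hμ : (ν.withDensity fun x => ‖u x‖ₑ ^ 2).map π = μ) :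
    ∃ V : Lp ℂ 2 μ →ₗᵢ[ℂ] Lp ℂ 2 ν, ∀ m : Lp ℂ 2 μ, V m =ᵐ[ν] fun x => m (π x) * u x := by
  have hmeas : ∀ m : Lp ℂ 2 μ, Measurable fun x => m (π x) * u x := fun m =>
    ((Lp_coeFn_measurable m).comp hπ).mul hu
  have hnorm : ∀ m : Lp ℂ 2 μ, eLpNorm (fun x => m (π x) * u x) 2 ν = ‖m‖ₑ := by
    intro m
    have h := lintegral_map_withDensity_enorm_sq hu hπ hμ
      ((Lp_coeFn_measurable m).enorm.pow_const 2)
    simp only [← mul_pow, ← enorm_mul] at h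
    rw [lintegral_enorm_sq_eq_eLpNorm, lintegral_enorm_Lp_sq] at h
    exact (ENNReal.pow_right_strictMono two_ne_zero).injective h
  have hmem : ∀ m : Lp ℂ 2 μ, MemLp (fun x => m (π x) * u x) 2 ν := fun m =>
    ⟨(hmeas m).aestronglyMeasurable, by rw [hnorm]; exact enorm_lt_top⟩
  refine ⟨⟨⟨⟨fun m => (hmem m).toLp _, fun m m' => ?_⟩, fun c m => ?_⟩, fun m => ?_⟩,
    fun m => (hmem m).coeFn_toLp⟩
  · rw [← MemLp.toLp_add]
    refine MemLp.toLp_congr _ _ ?_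
    filter_upwards [ae_mul_eq_of_ae_map_withDensity hu hπ hμ (Lp.coeFn_add m m')] with x hx
    rw [hx, Pi.add_apply, add_mul, Pi.add_apply]
  · refine Eq.trans ?_ (MemLp.toLp_const_smul c (hmem m))
    refine MemLp.toLp_congr (hmem _) _ ?_
    filter_upwards [ae_mul_eq_of_ae_map_withDensity hu hπ hμ (Lp.coeFn_smul c m)] with x hx
    rw [hx, Pi.smul_apply, Pi.smul_apply, smul_eq_mul, smul_eq_mul, mul_assoc]
  · change ‖(hmem m).toLp _‖ = ‖m‖
    rw [Lp.norm_toLp, hnorm, toReal_enorm]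

end Isometries

/-! ### Totality of the exponentials for finite measures on `(0,1]`. -/

section TrigonometricPolynomials

/-- The exponential `α ↦ e^{2πikα}`. -/
def expInt (k : ℤ) (α : ℝ) : ℂ := Complex.exp ((2 * Real.pi * α * k : ℝ) * Complex.I)

theorem norm_expInt (k : ℤ) (α : ℝ) : ‖expInt k α‖ = 1 := Complex.norm_exp_ofReal_mul_I _

theorem continuous_expInt (k : ℤ) : Continuous (expInt k) := by
  unfold expInt
  fun_prop

theorem expInt_add_intCast (k n : ℤ) (α : ℝ) : expInt k (α + n) = expInt k α := by
  have h : ((2 * Real.pi * (α + n) * k : ℝ) : ℂ) * Complex.I =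
      ((2 * Real.pi * α * k : ℝ) : ℂ) * Complex.I +
        ((n * k : ℤ) : ℂ) * (2 * Real.pi * Complex.I) := by
    push_cast
    ring
  rw [expInt, h, Complex.exp_add, Complex.exp_int_mul_two_pi_mul_I, mul_one, expInt]

theorem memLp_expInt (μ : Measure ℝ) [IsFiniteMeasure μ] (k : ℤ) : MemLp (expInt k) 2 μ :=
  MemLp.of_bound (continuous_expInt k).aestronglyMeasurable 1
    (ae_of_all _ fun α => (norm_expInt k α).le)

/-- Trigonometric polynomials are uniformly dense among continuous functions on the circle, which
are dense in `L²` of a finite measure. -/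
theorem span_fourier_toLp_topologicalClosure (μ : Measure UnitAddCircle) [IsFiniteMeasure μ] :
    (Submodule.span ℂ (range fun k : ℤ =>
      ContinuousMap.toLp 2 μ ℂ (_root_.fourier k : C(UnitAddCircle, ℂ)))).topologicalClosure =
      ⊤ := by
  have h := (ContinuousMap.toLp_denseRange ℂ μ ℂ
    (p := 2) ENNReal.ofNat_ne_top).topologicalClosure_map_submodule
      (span_fourier_closure_eq_top (T := 1))
  rw [Submodule.map_span, ← range_comp] at h
  exact h

/-- On `(0,1]` the projection to the circle has a measurable inverse `s`. Composition with the
projection is therefore a surjective isometry, which carries totality from the circle to the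
interval. -/
theorem span_expInt_topologicalClosure (μ : Measure ℝ) [IsFiniteMeasure μ]
    (hμ : ∀ᵐ α ∂μ, α ∈ Ioc (0 : ℝ) 1) :
    (Submodule.span ℂ (range fun k : ℤ => (memLp_expInt μ k).toLp _)).topologicalClosure = ⊤ := by
  let π : ℝ → UnitAddCircle := fun α => (α : UnitAddCircle)
  have hπ : Measurable π := AddCircle.measurable_mk'
  have hmp : MeasurePreserving π μ (μ.map π) := hπ.measurePreserving μ
  let s : UnitAddCircle → ℝ := fun x => (AddCircle.measurableEquivIoc 1 0 x : ℝ)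
  have hs : Measurable s := measurable_subtype_coe.comp (AddCircle.measurableEquivIoc 1 0).measurable
  have hsπ : ∀ α ∈ Ioc (0 : ℝ) 1, s (π α) = α := by
    intro α hα
    have h := (AddCircle.measurableEquivIoc 1 0).apply_symm_apply ⟨α, by simpa using hα⟩
    exact congrArg Subtype.val h
  let C : Lp ℂ 2 (μ.map π) →ₗᵢ[ℂ] Lp ℂ 2 μ := Lp.compMeasurePreservingₗᵢ ℂ π hmp
  have hC : Function.Surjective C := by
    intro m
    have hm1 : Measurable fun x => m (s x) := (Lp_coeFn_measurable m).comp hs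
    have hm2 : (fun α => m (s (π α))) =ᵐ[μ] m := by
      filter_upwards [hμ] with α hα
      rw [hsπ α hα]
    have hm3 : MemLp (fun x => m (s x)) 2 (μ.map π) := by
      refine (memLp_map_measure_iff hm1.aestronglyMeasurable hπ.aemeasurable).2 ?_
      exact (memLp_congr_ae hm2).2 (Lp.memLp m)
    refine ⟨hm3.toLp _, Lp.ext ?_⟩
    have h1 : C (hm3.toLp _) =ᵐ[μ] (hm3.toLp _) ∘ π := Lp.coeFn_compMeasurePreserving _ hmp
    refine h1.trans (EventuallyEq.trans ?_ hm2)
    exact ae_of_ae_map hπ.aemeasurable hm3.coeFn_toLp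
  have h := (hC.denseRange).topologicalClosure_map_submodule (f := C.toContinuousLinearMap)
    (span_fourier_toLp_topologicalClosure (μ.map π))
  rw [Submodule.map_span, ← range_comp] at h
  convert h using 4
  funext k
  refine Lp.ext ((memLp_expInt μ k).coeFn_toLp.trans ?_)
  have h1 : C (ContinuousMap.toLp 2 (μ.map π) ℂ (_root_.fourier k)) =ᵐ[μ]
    (ContinuousMap.toLp 2 (μ.map π) ℂ (_root_.fourier k : C(UnitAddCircle, ℂ))) ∘ π :=
      Lp.coeFn_compMeasurePreserving _ hmp
  refine EventuallyEq.trans ?_ h1.symm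
  have h2 := ae_of_ae_map hπ.aemeasurable
    (ContinuousMap.coeFn_toLp (p := 2) (𝕜 := ℂ) (μ.map π) (_root_.fourier k : C(UnitAddCircle, ℂ)))
  filter_upwards [h2] with α hα
  rw [Function.comp_apply, hα, fourier_coe_apply, expInt]
  congr 1
  push_cast
  ring

end TrigonometricPolynomials

/-! ### Folding the real line onto `(0,1]`. -/

section Periodization

/-- The intervals `(n, n + 1]` tile the line, and each is translated back to `(0,1]`. -/
theorem lintegral_eq_setLIntegral_tsum {G : ℝ → ℝ≥0∞} (hG : Measurable G) :
    ∫⁻ lam, G lam = ∫⁻ α in Ioc (0 : ℝ) 1, ∑' n : ℤ, G (α + n) := by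
  have hm : ∀ n : ℤ, Measurable fun α : ℝ => G (α + n) := fun n =>
    hG.comp (measurable_add_const (n : ℝ))
  rw [lintegral_tsum fun n => (hm n).aemeasurable]
  rw [← setLIntegral_univ, ← iUnion_Ioc_intCast ℝ,
    lintegral_iUnion (fun n => measurableSet_Ioc) (pairwise_disjoint_Ioc_intCast ℝ)]
  refine tsum_congr fun n => ?_
  rw [← (measurePreserving_add_right volume (n : ℝ)).setLIntegral_comp_preimage_emb
    (measurableEmbedding_addRight (n : ℝ))]
  simp

/-- The representative in `(0, 1]` of a real number modulo the integers. -/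
def modOne (lam : ℝ) : ℝ := 1 - Int.fract (-lam)

theorem measurable_modOne : Measurable modOne :=
  measurable_const.sub (measurable_fract.comp measurable_neg)

/-- Negation before the fractional part makes integers fold to `1` rather than `0`, matching the
half-open interval `(0,1]`. -/
theorem modOne_add_intCast {α : ℝ} (hα : α ∈ Ioc (0 : ℝ) 1) (n : ℤ) : modOne (α + n) = α := by
  have h : Int.fract (-(α + n)) = 1 - α := by
    rw [Int.fract_eq_iff]
    refine ⟨by linarith [hα.2], by linarith [hα.1], -n - 1, ?_⟩
    push_cast
    ring
  rw [modOne, h, sub_sub_cancel]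

theorem expInt_modOne (k : ℤ) (lam : ℝ) : expInt k (modOne lam) = expInt k lam := by
  have h : modOne lam = lam + ((1 + ⌊-lam⌋ : ℤ) : ℝ) := by
    rw [modOne, Int.fract]
    push_cast
    ring
  rw [h, expInt_add_intCast]

theorem ae_forall_add_intCast {P : ℝ → Prop} (h : ∀ᵐ lam : ℝ, P lam) :
    ∀ᵐ α : ℝ, ∀ n : ℤ, P (α + n) :=
  ae_all_iff.2 fun n => (measurePreserving_add_right volume (n : ℝ)).quasiMeasurePreserving.ae h

end Periodization

/-! ### The bracket as a periodization, and the isometry. -/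

section Bracket

variable {d : ℕ}

/-- The density `|λ|^d` is split as a square, one root for each factor. -/
theorem hsInner_mul_eq_tsum_coeffFun {F G : ℝ → L2E d →L[ℂ] L2E d} {lam : ℝ}
    (hF : hsNormSq (F lam) ≠ ∞) (hG : hsNormSq (G lam) ≠ ∞) :
    hsInner (F lam) (G lam) * ((|lam| ^ d : ℝ) : ℂ) =
      ∑' q, coeffFun F (lam, q) * starRingEnd ℂ (coeffFun G (lam, q)) := by
  rw [hsInner_eq_tsum_matrixCoeff hF hG, ← tsum_mul_right]
  refine tsum_congr fun q => ?_
  have h : ((|lam| ^ d : ℝ) : ℂ) = ((√(|lam| ^ d) : ℝ) : ℂ) * ((√(|lam| ^ d) : ℝ) : ℂ) := by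
    rw [← Complex.ofReal_mul, Real.mul_self_sqrt (by positivity)]
  rw [coeffFun, coeffFun, map_mul, Complex.conj_ofReal, h]
  ring

theorem bracket_ae_eq (φ ψ : L2H d) :
    ∀ᵐ α : ℝ, bracket φ ψ α = ∑' n : ℤ, ∑' q, plancherelMap d φ (α + n, q) *
      starRingEnd ℂ (plancherelMap d ψ (α + n, q)) := by
  filter_upwards [ae_forall_add_intCast (hsNormSq_fourier_ne_top φ),
    ae_forall_add_intCast (hsNormSq_fourier_ne_top ψ),
    ae_forall_add_intCast (ae_coeffMeasure_iff.1 (plancherelMap_ae_eq_fourier φ)),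
    ae_forall_add_intCast (ae_coeffMeasure_iff.1 (plancherelMap_ae_eq_fourier ψ))]
    with α h1 h2 h3 h4
  refine tsum_congr fun n => ?_
  rw [hsInner_mul_eq_tsum_coeffFun (h1 n) (h2 n)]
  refine tsum_congr fun q => ?_
  rw [h3, h4]

/-- The periodization of the squared coefficients of the Fourier transform. -/
def periodizedNormSq (ψ : L2H d) (α : ℝ) : ℝ≥0∞ :=
  ∑' n : ℤ, ∑' q, ‖plancherelMap d ψ (α + n, q)‖ₑ ^ 2

theorem measurable_tsum_enorm_plancherelMap_sq (ψ : L2H d) :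
    Measurable fun lam : ℝ => ∑' q, ‖plancherelMap d ψ (lam, q)‖ₑ ^ 2 :=
  Measurable.tsum fun _ =>
    ((Lp_coeFn_measurable (plancherelMap d ψ)).comp measurable_prodMk_right).enorm.pow_const 2

theorem measurable_periodizedNormSq (ψ : L2H d) : Measurable (periodizedNormSq ψ) :=
  Measurable.tsum fun n : ℤ => (measurable_tsum_enorm_plancherelMap_sq ψ).comp
    (measurable_add_const (n : ℝ))

theorem setLIntegral_periodizedNormSq (ψ : L2H d) :
    ∫⁻ α in Ioc (0 : ℝ) 1, periodizedNormSq ψ α = ‖ψ‖ₑ ^ 2 := by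
  have h := lintegral_eq_setLIntegral_tsum (measurable_tsum_enorm_plancherelMap_sq ψ)
  refine h.symm.trans ?_
  rw [← lintegral_coeffMeasure
    ((Lp_coeFn_measurable (plancherelMap d ψ)).enorm.pow_const 2).aemeasurable,
    lintegral_enorm_Lp_sq, ← ofReal_norm, LinearIsometry.norm_map, ofReal_norm]

/-- Since the periodization has integral `‖ψ‖²` it is finite almost everywhere. Hence taking the
real part and `ENNReal.ofReal` in `weight` loses nothing. -/
theorem bracket_self_ae_eq (ψ : L2H d) :
    ∀ᵐ α ∂volume.restrict (Ioc (0 : ℝ) 1),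
      bracket ψ ψ α = ((periodizedNormSq ψ α).toReal : ℂ) ∧ periodizedNormSq ψ α ≠ ∞ := by
  have hfin := ae_lt_top (μ := volume.restrict (Ioc (0 : ℝ) 1)) (measurable_periodizedNormSq ψ)
    (by rw [setLIntegral_periodizedNormSq]; simp)
  filter_upwards [hfin, ae_restrict_of_ae (bracket_ae_eq ψ ψ)] with α h1 h2
  refine ⟨?_, h1.ne⟩
  rw [h2, periodizedNormSq, ENNReal.tsum_toReal_eq (ENNReal.ne_top_of_tsum_ne_top h1.ne),
    Complex.ofReal_tsum]
  refine tsum_congr fun n => ?_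
  rw [ENNReal.tsum_toReal_eq (by simp), Complex.ofReal_tsum]
  refine tsum_congr fun q => ?_
  rw [Complex.mul_conj, Complex.normSq_eq_norm_sq, ENNReal.toReal_pow, toReal_enorm]

theorem weight_eq_withDensity (ψ : L2H d) :
    weight ψ = (volume.restrict (Ioc (0 : ℝ) 1)).withDensity (periodizedNormSq ψ) := by
  refine withDensity_congr_ae ?_
  filter_upwards [bracket_self_ae_eq ψ] with α h
  rw [h.1, Complex.ofReal_re, ENNReal.ofReal_toReal h.2]

instance (ψ : L2H d) : IsFiniteMeasure (weight ψ) := by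
  rw [weight_eq_withDensity]
  refine isFiniteMeasure_withDensity ?_
  rw [setLIntegral_periodizedNormSq]
  simp

theorem weight_absolutelyContinuous (ψ : L2H d) :
    weight ψ ≪ volume.restrict (Ioc (0 : ℝ) 1) :=
  withDensity_absolutelyContinuous _ _

/-- Summing `|u|²` over matrix indices and integer translates gives the density of the weight. This
is the hypothesis under which multiplication by `u` is an isometry on the weighted space. -/
theorem map_withDensity_plancherelMap (ψ : L2H d) :
    ((coeffMeasure d).withDensity fun z => ‖plancherelMap d ψ z‖ₑ ^ 2).map
      (fun z => modOne z.1) = weight ψ := by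
  have hum := Lp_coeFn_measurable (plancherelMap d ψ)
  have hπ : Measurable fun z : ℝ × CoeffIndex d => modOne z.1 :=
    measurable_modOne.comp measurable_fst
  ext s hs
  have hm : Measurable fun lam : ℝ =>
      (modOne ⁻¹' s).indicator (fun lam => ∑' q, ‖plancherelMap d ψ (lam, q)‖ₑ ^ 2) lam :=
    (measurable_tsum_enorm_plancherelMap_sq ψ).indicator (measurable_modOne hs)
  rw [Measure.map_apply hπ hs, withDensity_apply _ (hπ hs), ← lintegral_indicator (hπ hs),
    lintegral_coeffMeasure ((hum.enorm.pow_const 2).indicator (hπ hs)).aemeasurable,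
    weight_eq_withDensity, withDensity_apply _ hs, ← lintegral_indicator hs]
  refine Eq.trans ?_ ((lintegral_eq_setLIntegral_tsum hm).trans ?_)
  · refine lintegral_congr fun lam => ?_
    by_cases h : modOne lam ∈ s
    · simp [indicator, h]
    · simp [indicator, h]
  · refine setLIntegral_congr_fun measurableSet_Ioc fun α hα => ?_
    by_cases h : α ∈ s
    · simp [indicator, modOne_add_intCast hα, h, periodizedNormSq]
    · simp [indicator, modOne_add_intCast hα, h]

/-- If the coefficients of `φ` are those of `ψ` times the periodic extension of `m`, then `m` is
the quotient of brackets. -/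
theorem ae_eq_bracketQuotient {φ ψ : L2H d} {m : ℝ → ℂ}
    (h : ∀ᵐ z ∂coeffMeasure d,
      plancherelMap d φ z = m (modOne z.1) * plancherelMap d ψ z) :
    m =ᵐ[weight ψ] bracketQuotient ψ φ := by
  -- The weight does not charge the zero set of its own density, so `[ψ,ψ]` may be divided by.
  have hpos : ∀ᵐ α ∂weight ψ, periodizedNormSq ψ α ≠ 0 := by
    rw [weight_eq_withDensity, ae_withDensity_iff (measurable_periodizedNormSq ψ)]
    exact ae_of_all _ fun α hα => hα
  have hac := weight_absolutelyContinuous ψ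
  filter_upwards [hpos, hac.ae_le (ae_restrict_mem measurableSet_Ioc),
    hac.ae_le (bracket_self_ae_eq ψ), hac.ae_le (ae_restrict_of_ae (bracket_ae_eq φ ψ)),
    hac.ae_le (ae_restrict_of_ae (bracket_ae_eq ψ ψ)),
    hac.ae_le (ae_restrict_of_ae (ae_forall_add_intCast (ae_coeffMeasure_iff.1 h)))]
    with α h0 hα h1 h2 h3 h4
  -- All points `α + n` fold to `α`, so `m α` is a common factor of both sums; `tsum_mul_left`
  -- extracts it without any summability hypothesis.
  have h5 : bracket φ ψ α = m α * bracket ψ ψ α := by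
    rw [h2, h3, ← tsum_mul_left]
    refine tsum_congr fun n => ?_
    rw [← tsum_mul_left]
    refine tsum_congr fun q => ?_
    rw [h4 n q, modOne_add_intCast hα, mul_assoc]
  have h6 : 0 < (bracket ψ ψ α).re := by
    rw [h1.1, Complex.ofReal_re]
    exact ENNReal.toReal_pos h0 h1.2
  have h7 : bracket ψ ψ α ≠ 0 := fun h => by simp [h] at h6
  have h8 : α ∈ positiveSet ψ := ⟨hα, h6⟩
  rw [bracketQuotient, indicator_of_mem h8, h5, mul_div_cancel_right₀ _ h7]

/-- The map `φ ↦ S_ψ[φ]` is a linear isometry of the cyclic subspace onto the weighted space. -/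
theorem exists_bracketQuotient_isometry (ψ : L2H d) :
    ∃ S : cyclicSubspace ψ ≃ₗᵢ[ℂ] Lp ℂ 2 (weight ψ),
      ∀ φ : cyclicSubspace ψ, S φ =ᵐ[weight ψ] bracketQuotient ψ φ := by
  have hum := Lp_coeFn_measurable (plancherelMap d ψ)
  obtain ⟨V, hV⟩ := exists_linearIsometry_comp_mul hum
    (measurable_modOne.comp measurable_fst) (map_withDensity_plancherelMap ψ)
  have hmem : ∀ᵐ α ∂weight ψ, α ∈ Ioc (0 : ℝ) 1 :=
    (weight_absolutelyContinuous ψ).ae_le (ae_restrict_mem measurableSet_Ioc)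
  -- Both sides are `e^{2πikλ} u`: the exponential has integer frequency, so folding `λ` does not
  -- change it.
  have hab : ∀ k : ℤ, plancherelMap d (leftTranslation (central d k) ψ) =
      V ((memLp_expInt (weight ψ) k).toLp _) := by
    intro k
    refine Lp.ext ?_
    filter_upwards [plancherelMap_leftTranslation_central ψ k, plancherelMap_ae_eq_fourier ψ,
      hV ((memLp_expInt (weight ψ) k).toLp _),
      ae_mul_eq_of_ae_map_withDensity hum (measurable_modOne.comp measurable_fst)
        (map_withDensity_plancherelMap ψ) (memLp_expInt (weight ψ) k).coeFn_toLp]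
      with z h1 h2 h3 h4
    rw [h1, h3, h4, ← h2, Function.comp_apply, expInt_modOne, expInt]
  obtain ⟨S, hS⟩ := exists_linearIsometryEquiv_of_total (plancherelMap d) V _ _ hab
    (span_expInt_topologicalClosure (weight ψ) hmem)
  refine ⟨S, fun φ => ae_eq_bracketQuotient ?_⟩
  -- As `V (S φ) = Uφ`, the formula for `V` exhibits the coefficients of `φ` as a periodic multiple
  -- of those of `ψ`.
  have h := hV (S φ)
  rw [hS φ] at h
  exact h

end Bracket

end HeisenbergBracket

end

theorem theorem1p2 (d : ℕ) (ψ : HeisenbergBracket.L2H d) :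
    ∃ S : HeisenbergBracket.cyclicSubspace ψ ≃ₗᵢ[ℂ]
        MeasureTheory.Lp ℂ 2 (HeisenbergBracket.weight ψ),
      ∀ φ : HeisenbergBracket.cyclicSubspace ψ,
        S φ =ᵐ[HeisenbergBracket.weight ψ] HeisenbergBracket.bracketQuotient ψ φ :=
  HeisenbergBracket.exists_bracketQuotient_isometry ψ
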